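/- Let $\mathrm{Aff}(3)$ be the group of all affine transformations $w\mapsto Bw+b$ of $\mathbb R^3$ with $\det B\neq 0$, and let a surface be a smooth embedded 2-dimensional submanifold of $\mathbb R^3$ (without boundary, not necessarily closed or connected). A surface $S$ is called regular elliptical if at each of its points $P$ some affine transformation takes $P$ to the origin and the germ of $S$ at $P$ to a germ of the form $$z=\tfrac12(x^2+y^2)+\tfrac16(x^3-3xy^2)+O\big(|(x,y)|^4\big).$$ The fourth order coefficients in such a normal form, $$z=\tfrac12(x^2+y^2)+\tfrac16(x^3-3xy^2)+\tfrac1{24}\big(I_{40}x^4+4I_{31}x^3y+6I_{22}x^2y^2+4I_{13}xy^3+I_{04}y^4\big)+O\big(|(x,y)|^5\big),$$ are the fundamental curvatures of $S$ at $P$ (the normalizing transformation, hence the 5-tuple of curvatures, is unique up to the symmetry group $D_3$ of the standard 3-jet). $S$ has constant curvatures $(I_{40},I_{31},I_{22},I_{13},I_{04})\in\mathbb R^5$ if this fixed 5-tuple is a 5-tuple of fundamental curvatures of $S$ at every point of $S$. **Theorem 5.3.** A regular elliptical surface with constant curvatures is determined, locally, by the constants $I_{40},I_{31},I_{22},I_{13},I_{04}$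 up to affine congruence: if $S$ and $S'$ are regular elliptical surfaces which both have constant curvatures $(I_{40},I_{31},I_{22},I_{13},I_{04})$, then for all points $P\in S$ and $P'\in S'$ there are $T\in\mathrm{Aff}(3)$ with $T(P)=P'$ and an open neighbourhood $V$ of $P'$ in $\mathbb R^3$ such that $T(S)\cap V=S'\cap V$. -/

import Mathlib

open scoped Topology ContDiff

namespace EllipticalSurface

/-- Affine 3-space with its coordinates `x = w 0`, `y = w 1`, `z = w 2`. Its general affine group
`Aff(3)` (all `w ↦ B w + b` with `det B ≠ 0`) is `A3 ≃ᵃ[ℝ] A3`. -/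
abbrev A3 : Type := Fin 3 → ℝ

/-- In the affine coordinates given by `T`, which put the origin at `p`, the set `S` is near `p`
the graph `z = u(x, y)` of a smooth (`C^∞`) function `u` defined near `(0, 0)`. -/
structure IsGraphAt (S : Set A3) (p : A3) (T : A3 ≃ᵃ[ℝ] A3) (u : ℝ × ℝ → ℝ) : Prop where
  map_base : T p = 0
  smooth : ∃ U : Set (ℝ × ℝ), IsOpen U ∧ (0, 0) ∈ U ∧ ContDiffOn ℝ ∞ u U
  graph : ∃ V : Set A3, IsOpen V ∧ p ∈ V ∧ ∀ w ∈ V, (w ∈ S ↔ T w 2 = u (T w 0, T w 1))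

/-- `S` is a smooth (embedded) surface in `A^3`: around each of its points it is, in suitable
affine coordinates, the graph of a smooth function. -/
def IsSmoothSurface (S : Set A3) : Prop :=
  ∀ p ∈ S, ∃ (T : A3 ≃ᵃ[ℝ] A3) (u : ℝ × ℝ → ℝ), IsGraphAt S p T u

/-- An affine transformation brings the jet of order `k` of `S` at `p` to the form
`z = f(x, y) + (terms of order > k)` at the origin. -/
def JetTransformsTo (S : Set A3) (p : A3) (k : ℕ) (f : ℝ × ℝ → ℝ) : Prop :=
  ∃ (T : A3 ≃ᵃ[ℝ] A3) (u : ℝ × ℝ → ℝ), IsGraphAt S p T u ∧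
    (fun q => u q - f q) =o[𝓝 (0, 0)] (fun q => ‖q‖ ^ k)

/-- The quadratic part `(x² + y²) / 2` of an elliptical jet in standard form. -/
noncomputable def quadraticPart (q : ℝ × ℝ) : ℝ := (1 / 2) * (q.1 ^ 2 + q.2 ^ 2)

/-- The cubic part `(x³ - 3 x y²) / 6` of a regular elliptical jet in standard form. -/
noncomputable def cubicPart (q : ℝ × ℝ) : ℝ := (1 / 6) * (q.1 ^ 3 - 3 * q.1 * q.2 ^ 2)

/-- The quartic part `(1/4!) ∑_{i+j=4} (4 choose i) a_{ij} x^i y^j`. -/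
noncomputable def quarticPart (a40 a31 a22 a13 a04 : ℝ) (q : ℝ × ℝ) : ℝ :=
  (1 / 24) * (a40 * q.1 ^ 4 + 4 * a31 * q.1 ^ 3 * q.2 + 6 * a22 * q.1 ^ 2 * q.2 ^ 2
    + 4 * a13 * q.1 * q.2 ^ 3 + a04 * q.2 ^ 4)

/-- The point `p` of `S` is elliptical. -/
def IsEllipticalAt (S : Set A3) (p : A3) : Prop :=
  JetTransformsTo S p 2 quadraticPart

/-- The point `p` of `S` is elliptical and regular. -/
def IsRegularEllipticalAt (S : Set A3) (p : A3) : Prop :=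
  IsEllipticalAt S p ∧ JetTransformsTo S p 3 (fun q => quadraticPart q + cubicPart q)

/-- `S` is a regular elliptical surface. -/
def IsRegularElliptical (S : Set A3) : Prop :=
  IsSmoothSurface S ∧ ∀ p ∈ S, IsRegularEllipticalAt S p

/-- `(I40, …, I04)` are the fundamental curvatures of `S` at `p`: the fourth order coefficients of
`S` at `p` in affine coordinates in which the 3-jet is standard. Such coordinates exist up to the
symmetry group `D_3` of the standard 3-jet, so the curvatures are defined up to its action. -/
def HasCurvaturesAt (S : Set A3) (p : A3) (I40 I31 I22 I13 I04 : ℝ) : Prop :=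
  JetTransformsTo S p 4
    (fun q => quadraticPart q + cubicPart q + quarticPart I40 I31 I22 I13 I04 q)

/-- `S` has constant curvatures, equal to the given numbers. -/
def HasConstantCurvatures (S : Set A3) (I40 I31 I22 I13 I04 : ℝ) : Prop :=
  ∀ p ∈ S, HasCurvaturesAt S p I40 I31 I22 I13 I04

/-- An affine transformation takes `p` to `p'` and the germ of `S` at `p` to the germ of `S'` at
`p'`. -/
def AffinelyCongruentAt (S : Set A3) (p : A3) (S' : Set A3) (p' : A3) : Prop :=
  ∃ T : A3 ≃ᵃ[ℝ] A3, T p = p' ∧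
    ∃ V : Set A3, IsOpen V ∧ p' ∈ V ∧ (T '' S) ∩ V = S' ∩ V

end EllipticalSurface

namespace EllipticalSurface

/-! The surface satisfies an equation of finite type: its fourth derivatives are a function of its
second and third ones, and such a function is fixed by its 3-jet at one point.

Near a point, normalizing coordinates present the surface as the graph of `u` with standard jet. At
each nearby point some other affine coordinates normalize the 4-jet to the same quartic part `f`.
Expanding the curves `s ↦ (s w, v (s w))` of that second graph in the first coordinates
(`jet_equations`) and eliminating the transversal direction (`exists_frame_of_relations`) expresses
the second, third and fourth differentials of `u` by explicit formulas in a frame with seven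
parameters: a scale, a linear map and a vector.

There are also seven second and third derivatives. The map `frameJet` from frames to these
derivatives has an injective differential at the standard frame, so it has a local inverse `ε`. The
frame supplied by the curvatures need not be `ε` of the jet and need not vary continuously, but the
two differ only by an element of the finite group `D_3` (`exists_symmetry`). Such a symmetry
replaces `f` by `f ∘ m`; if `f ∘ m ≠ f`, continuity at the base point excludes it nearby
(`eventually_form4_eq`). Hence the fourth derivatives equal a fixed locally Lipschitz function `G`
of the lower ones, and `G` depends only on the five constants.

Two surfaces with the same constants therefore give graph functions with equal initial jets and the
same `G`. Along each ray this is an ordinary differential equation for the jets, and Gronwall's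
inequality makes the functions equal near the origin (`eqOn_ball_of_quarticCoeffs`). Composing the
two normalizing coordinate systems is the congruence. -/

/-! ### Partial derivatives on open sets and their symmetry -/

/-- The partial derivative with respect to the first variable. -/
noncomputable def dx (u : ℝ × ℝ → ℝ) (q : ℝ × ℝ) : ℝ := fderiv ℝ u q (1, 0)

/-- The partial derivative with respect to the second variable. -/
noncomputable def dy (u : ℝ × ℝ → ℝ) (q : ℝ × ℝ) : ℝ := fderiv ℝ u q (0, 1)

/-- The iterated partial derivative `∂x^i ∂y^j u`. -/
noncomputable def partialDeriv (i j : ℕ) (u : ℝ × ℝ → ℝ) : ℝ × ℝ → ℝ := dx^[i] (dy^[j] u)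

theorem contDiffOn_dx {u : ℝ × ℝ → ℝ} {U : Set (ℝ × ℝ)} (hU : IsOpen U)
    (hu : ContDiffOn ℝ ∞ u U) : ContDiffOn ℝ ∞ (dx u) U :=
  (hu.fderiv_of_isOpen hU (m := ∞) (by simp)).clm_apply contDiffOn_const

theorem contDiffOn_dy {u : ℝ × ℝ → ℝ} {U : Set (ℝ × ℝ)} (hU : IsOpen U)
    (hu : ContDiffOn ℝ ∞ u U) : ContDiffOn ℝ ∞ (dy u) U :=
  (hu.fderiv_of_isOpen hU (m := ∞) (by simp)).clm_apply contDiffOn_const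

theorem contDiffOn_iterate_dx {u : ℝ × ℝ → ℝ} {U : Set (ℝ × ℝ)} (hU : IsOpen U)
    (hu : ContDiffOn ℝ ∞ u U) (i : ℕ) : ContDiffOn ℝ ∞ (dx^[i] u) U := by
  induction i with
  | zero => exact hu
  | succ i ih => rw [Function.iterate_succ_apply']; exact contDiffOn_dx hU ih

theorem contDiffOn_iterate_dy {u : ℝ × ℝ → ℝ} {U : Set (ℝ × ℝ)} (hU : IsOpen U)
    (hu : ContDiffOn ℝ ∞ u U) (i : ℕ) : ContDiffOn ℝ ∞ (dy^[i] u) U := by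
  induction i with
  | zero => exact hu
  | succ i ih => rw [Function.iterate_succ_apply']; exact contDiffOn_dy hU ih

theorem contDiffOn_partialDeriv {u : ℝ × ℝ → ℝ} {U : Set (ℝ × ℝ)} (hU : IsOpen U)
    (hu : ContDiffOn ℝ ∞ u U) (i j : ℕ) : ContDiffOn ℝ ∞ (partialDeriv i j u) U :=
  contDiffOn_iterate_dx hU (contDiffOn_iterate_dy hU hu j) i

theorem dx_congr {u v : ℝ × ℝ → ℝ} {U : Set (ℝ × ℝ)} (hU : IsOpen U) (h : Set.EqOn u v U) :
    Set.EqOn (dx u) (dx v) U := fun q hq => by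
  rw [dx, dx, (h.eventuallyEq_of_mem (hU.mem_nhds hq)).fderiv_eq]

theorem dy_dx {u : ℝ × ℝ → ℝ} {U : Set (ℝ × ℝ)} (hU : IsOpen U)
    (hu : ContDiffOn ℝ ∞ u U) : Set.EqOn (dy (dx u)) (dx (dy u)) U := fun q hq => by
  have hd : DifferentiableAt ℝ (fderiv ℝ u) q :=
    ((hu.fderiv_of_isOpen hU (m := ∞) (by simp)).contDiffAt (hU.mem_nhds hq)).differentiableAt
      (by simp)
  have hs : IsSymmSndFDerivAt ℝ u q :=
    (hu.contDiffAt (hU.mem_nhds hq)).isSymmSndFDerivAt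
      (by simpa using WithTop.coe_le_coe.2 (le_top (a := (2 : ℕ∞))))
  have key : ∀ v w : ℝ × ℝ, fderiv ℝ (fun p => fderiv ℝ u p v) q w
      = fderiv ℝ (fderiv ℝ u) q w v := fun v w => by
    rw [fderiv_clm_apply hd (by fun_prop)]
    simp
  change fderiv ℝ (fun p => fderiv ℝ u p (1, 0)) q (0, 1)
    = fderiv ℝ (fun p => fderiv ℝ u p (0, 1)) q (1, 0)
  rw [key, key, hs.eq]

theorem dy_iterate_dx {u : ℝ × ℝ → ℝ} {U : Set (ℝ × ℝ)} (hU : IsOpen U)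
    (hu : ContDiffOn ℝ ∞ u U) (i : ℕ) : Set.EqOn (dy (dx^[i] u)) (dx^[i] (dy u)) U := by
  induction i with
  | zero => exact fun _ _ => rfl
  | succ i ih =>
    rw [Function.iterate_succ_apply', Function.iterate_succ_apply']
    exact (dy_dx hU (contDiffOn_iterate_dx hU hu i)).trans (dx_congr hU ih)

theorem dy_partialDeriv {u : ℝ × ℝ → ℝ} {U : Set (ℝ × ℝ)} (hU : IsOpen U)
    (hu : ContDiffOn ℝ ∞ u U) (i j : ℕ) :
    Set.EqOn (dy (partialDeriv i j u)) (partialDeriv i (j + 1) u) U := by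
  have := dy_iterate_dx hU (contDiffOn_iterate_dy hU hu j) i
  rwa [← Function.iterate_succ_apply' dy] at this

theorem dx_partialDeriv (u : ℝ × ℝ → ℝ) (i j : ℕ) :
    dx (partialDeriv i j u) = partialDeriv (i + 1) j u :=
  (Function.iterate_succ_apply' dx i _).symm

/-- Chain rule along a line; commuting mixed partials bring the `dy` derivative back to the normal
order in which all `dx` are outermost. -/
theorem hasDerivAt_partialDeriv_line {u : ℝ × ℝ → ℝ} {U : Set (ℝ × ℝ)} (hU : IsOpen U)
    (hu : ContDiffOn ℝ ∞ u U) (i j : ℕ) {q h : ℝ × ℝ} {t : ℝ} (ht : q + t • h ∈ U) :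
    HasDerivAt (fun s : ℝ => partialDeriv i j u (q + s • h))
      (h.1 * partialDeriv (i + 1) j u (q + t • h) + h.2 * partialDeriv i (j + 1) u (q + t • h))
      t := by
  have h1 := (((contDiffOn_partialDeriv hU hu i j).contDiffAt (hU.mem_nhds ht)).differentiableAt
    (by simp)).hasFDerivAt
  have h2 : HasDerivAt (fun s : ℝ => q + s • h) h t := by
    simpa using ((hasDerivAt_id t).smul_const h).const_add q
  refine (h1.comp_hasDerivAt t h2).congr_deriv ?_
  rw [← dx_partialDeriv, ← dy_partialDeriv hU hu i j ht, dx, dy]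
  generalize fderiv ℝ (partialDeriv i j u) (q + t • h) = L
  conv_lhs => rw [show h = h.1 • ((1 : ℝ), (0 : ℝ)) + h.2 • ((0 : ℝ), (1 : ℝ)) by ext <;> simp]
  rw [map_add, map_smul, map_smul]
  rfl

/-! ### Differentials up to order four and Taylor's formula -/

/-- The first differential of `u` at `q`, evaluated on `h`. -/
noncomputable def form1 (u : ℝ × ℝ → ℝ) (q h : ℝ × ℝ) : ℝ :=
  partialDeriv 1 0 u q * h.1 + partialDeriv 0 1 u q * h.2

/-- The second differential of `u` at `q`, evaluated on `(h, h)`. -/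
noncomputable def form2 (u : ℝ × ℝ → ℝ) (q h : ℝ × ℝ) : ℝ :=
  partialDeriv 2 0 u q * h.1 ^ 2 + 2 * partialDeriv 1 1 u q * h.1 * h.2
    + partialDeriv 0 2 u q * h.2 ^ 2

/-- The third differential of `u` at `q`, evaluated on `(h, h, h)`. -/
noncomputable def form3 (u : ℝ × ℝ → ℝ) (q h : ℝ × ℝ) : ℝ :=
  partialDeriv 3 0 u q * h.1 ^ 3 + 3 * partialDeriv 2 1 u q * h.1 ^ 2 * h.2
    + 3 * partialDeriv 1 2 u q * h.1 * h.2 ^ 2 + partialDeriv 0 3 u q * h.2 ^ 3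

/-- The fourth differential of `u` at `q`, evaluated on `(h, h, h, h)`. -/
noncomputable def form4 (u : ℝ × ℝ → ℝ) (q h : ℝ × ℝ) : ℝ :=
  partialDeriv 4 0 u q * h.1 ^ 4 + 4 * partialDeriv 3 1 u q * h.1 ^ 3 * h.2
    + 6 * partialDeriv 2 2 u q * h.1 ^ 2 * h.2 ^ 2
    + 4 * partialDeriv 1 3 u q * h.1 * h.2 ^ 3 + partialDeriv 0 4 u q * h.2 ^ 4

theorem hasDerivAt_form0 {u : ℝ × ℝ → ℝ} {U : Set (ℝ × ℝ)} (hU : IsOpen U)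
    (hu : ContDiffOn ℝ ∞ u U) {q h : ℝ × ℝ} {t : ℝ} (ht : q + t • h ∈ U) :
    HasDerivAt (fun s : ℝ => u (q + s • h)) (form1 u (q + t • h) h) t := by
  refine (hasDerivAt_partialDeriv_line hU hu 0 0 ht).congr_deriv ?_
  simp only [form1]; ring

theorem hasDerivAt_form1 {u : ℝ × ℝ → ℝ} {U : Set (ℝ × ℝ)} (hU : IsOpen U)
    (hu : ContDiffOn ℝ ∞ u U) {q h : ℝ × ℝ} {t : ℝ} (ht : q + t • h ∈ U) :
    HasDerivAt (fun s : ℝ => form1 u (q + s • h) h) (form2 u (q + t • h) h) t := by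
  have d := fun i j => hasDerivAt_partialDeriv_line hU hu i j ht
  refine (((d 1 0).mul_const h.1).add ((d 0 1).mul_const h.2)).congr_deriv ?_
  simp only [form2]; ring

theorem hasDerivAt_form2 {u : ℝ × ℝ → ℝ} {U : Set (ℝ × ℝ)} (hU : IsOpen U)
    (hu : ContDiffOn ℝ ∞ u U) {q h : ℝ × ℝ} {t : ℝ} (ht : q + t • h ∈ U) :
    HasDerivAt (fun s : ℝ => form2 u (q + s • h) h) (form3 u (q + t • h) h) t := by
  have d := fun i j => hasDerivAt_partialDeriv_line hU hu i j ht
  refine ((((d 2 0).mul_const (h.1 ^ 2)).add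
    ((((d 1 1).const_mul 2).mul_const h.1).mul_const h.2)).add
    ((d 0 2).mul_const (h.2 ^ 2))).congr_deriv ?_
  simp only [form3]; ring

theorem hasDerivAt_form3 {u : ℝ × ℝ → ℝ} {U : Set (ℝ × ℝ)} (hU : IsOpen U)
    (hu : ContDiffOn ℝ ∞ u U) {q h : ℝ × ℝ} {t : ℝ} (ht : q + t • h ∈ U) :
    HasDerivAt (fun s : ℝ => form3 u (q + s • h) h) (form4 u (q + t • h) h) t := by
  have d := fun i j => hasDerivAt_partialDeriv_line hU hu i j ht
  refine (((((d 3 0).mul_const (h.1 ^ 3)).add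
    ((((d 2 1).const_mul 3).mul_const (h.1 ^ 2)).mul_const h.2)).add
    ((((d 1 2).const_mul 3).mul_const h.1).mul_const (h.2 ^ 2))).add
    ((d 0 3).mul_const (h.2 ^ 3))).congr_deriv ?_
  simp only [form4]; ring

theorem abs_sub_le_of_hasDerivAt {g g' : ℝ → ℝ} {C : ℝ}
    (hg : ∀ t ∈ Set.Icc (0 : ℝ) 1, HasDerivAt g (g' t) t)
    (bound : ∀ t ∈ Set.Icc (0 : ℝ) 1, |g' t| ≤ C) (hC : 0 ≤ C) (h0 : g 0 = 0) :
    ∀ t ∈ Set.Icc (0 : ℝ) 1, |g t| ≤ C := fun t ht => by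
  have := norm_image_sub_le_of_norm_deriv_le_segment' (f := g) (a := 0) (b := 1) (C := C)
    (fun x hx => (hg x hx).hasDerivWithinAt) (fun x hx => bound x (Set.Ico_subset_Icc_self hx)) t ht
  rw [h0, sub_zero, sub_zero, Real.norm_eq_abs] at this
  exact this.trans (mul_le_of_le_one_right hC ht.2)

/-- Subtracting the Taylor polynomial and applying the mean value inequality four times on the unit
interval carries the bound on `g4 t - g4 0` up to `g0`. The factor 1/24 is given away, since only a
small `C` matters. -/
theorem taylor_four_bound {g0 g1 g2 g3 g4 : ℝ → ℝ} {C : ℝ}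
    (h0 : ∀ t ∈ Set.Icc (0 : ℝ) 1, HasDerivAt g0 (g1 t) t)
    (h1 : ∀ t ∈ Set.Icc (0 : ℝ) 1, HasDerivAt g1 (g2 t) t)
    (h2 : ∀ t ∈ Set.Icc (0 : ℝ) 1, HasDerivAt g2 (g3 t) t)
    (h3 : ∀ t ∈ Set.Icc (0 : ℝ) 1, HasDerivAt g3 (g4 t) t)
    (hC : ∀ t ∈ Set.Icc (0 : ℝ) 1, |g4 t - g4 0| ≤ C) :
    |g0 1 - (g0 0 + g1 0 + g2 0 / 2 + g3 0 / 6 + g4 0 / 24)| ≤ C := by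
  have hC0 : 0 ≤ C := (abs_nonneg _).trans (hC 0 (by simp))
  have p : ∀ (n : ℕ) (t : ℝ), HasDerivAt (fun s : ℝ => s ^ n) (n * t ^ (n - 1)) t :=
    fun n t => hasDerivAt_pow n t
  have b3 := abs_sub_le_of_hasDerivAt (g := fun t => g3 t - g3 0 - g4 0 * t ^ 1)
    (g' := fun t => g4 t - g4 0)
    (fun t ht => (((h3 t ht).sub_const _).sub ((p 1 t).const_mul _)).congr_deriv (by simp))
    hC hC0 (by simp)
  have b2 := abs_sub_le_of_hasDerivAt (g := fun t => g2 t - g2 0 - g3 0 * t ^ 1 - g4 0 / 2 * t ^ 2)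
    (g' := fun t => g3 t - g3 0 - g4 0 * t ^ 1)
    (fun t ht => ((((h2 t ht).sub_const _).sub ((p 1 t).const_mul _)).sub
      ((p 2 t).const_mul _)).congr_deriv (by norm_num; ring)) b3 hC0 (by simp)
  have b1 := abs_sub_le_of_hasDerivAt
    (g := fun t => g1 t - g1 0 - g2 0 * t ^ 1 - g3 0 / 2 * t ^ 2 - g4 0 / 6 * t ^ 3)
    (g' := fun t => g2 t - g2 0 - g3 0 * t ^ 1 - g4 0 / 2 * t ^ 2)
    (fun t ht => (((((h1 t ht).sub_const _).sub ((p 1 t).const_mul _)).sub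
      ((p 2 t).const_mul _)).sub ((p 3 t).const_mul _)).congr_deriv (by norm_num; ring))
      b2 hC0 (by simp)
  have b0 := abs_sub_le_of_hasDerivAt
    (g := fun t => g0 t - g0 0 - g1 0 * t ^ 1 - g2 0 / 2 * t ^ 2 - g3 0 / 6 * t ^ 3
      - g4 0 / 24 * t ^ 4)
    (g' := fun t => g1 t - g1 0 - g2 0 * t ^ 1 - g3 0 / 2 * t ^ 2 - g4 0 / 6 * t ^ 3)
    (fun t ht => ((((((h0 t ht).sub_const _).sub ((p 1 t).const_mul _)).sub
      ((p 2 t).const_mul _)).sub ((p 3 t).const_mul _)).sub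
      ((p 4 t).const_mul _)).congr_deriv (by norm_num; ring))
      b1 hC0 (by simp)
  have := b0 1 (by simp)
  convert this using 2
  ring

/-- The constant is the sum of binomial coefficients 1 + 4 + 6 + 4 + 1 = 16. -/
theorem abs_form4_sub_le {u : ℝ × ℝ → ℝ} {p q : ℝ × ℝ} {δ : ℝ}
    (h : ∀ i ∈ Finset.range 5, ∀ j ∈ Finset.range 5,
      |partialDeriv i j u p - partialDeriv i j u q| ≤ δ) (w : ℝ × ℝ) :
    |form4 u p w - form4 u q w| ≤ 16 * δ * ‖w‖ ^ 4 := by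
  have h1 : |w.1| ≤ ‖w‖ := norm_fst_le w
  have h2 : |w.2| ≤ ‖w‖ := norm_snd_le w
  have m : ∀ i j : ℕ, i + j = 4 → |(partialDeriv i j u p - partialDeriv i j u q)
      * (w.1 ^ i * w.2 ^ j)| ≤ δ * ‖w‖ ^ 4 := fun i j hij => by
    rw [abs_mul, abs_mul, abs_pow, abs_pow, ← hij, pow_add]
    have := h i (by simp; omega) j (by simp; omega)
    gcongr
    exact (abs_nonneg _).trans this
  have m0 := abs_le.1 (m 4 0 rfl)
  have m1 := abs_le.1 (m 3 1 rfl)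
  have m2 := abs_le.1 (m 2 2 rfl)
  have m3 := abs_le.1 (m 1 3 rfl)
  have m4 := abs_le.1 (m 0 4 rfl)
  have e : form4 u p w - form4 u q w
      = (partialDeriv 4 0 u p - partialDeriv 4 0 u q) * (w.1 ^ 4 * w.2 ^ 0)
      + 4 * ((partialDeriv 3 1 u p - partialDeriv 3 1 u q) * (w.1 ^ 3 * w.2 ^ 1))
      + 6 * ((partialDeriv 2 2 u p - partialDeriv 2 2 u q) * (w.1 ^ 2 * w.2 ^ 2))
      + 4 * ((partialDeriv 1 3 u p - partialDeriv 1 3 u q) * (w.1 ^ 1 * w.2 ^ 3))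
      + (partialDeriv 0 4 u p - partialDeriv 0 4 u q) * (w.1 ^ 0 * w.2 ^ 4) := by
    simp only [form4]; ring
  rw [e, abs_le]
  constructor <;> linarith [m0.1, m0.2, m1.1, m1.2, m2.1, m2.2, m3.1, m3.2, m4.1, m4.2]

/-- Taylor's formula of order four in two variables, with Peano remainder. -/
theorem taylor_four {u : ℝ × ℝ → ℝ} {U : Set (ℝ × ℝ)} (hU : IsOpen U)
    (hu : ContDiffOn ℝ ∞ u U) {q : ℝ × ℝ} (hq : q ∈ U) :
    (fun h : ℝ × ℝ => u (q + h)
      - (u q + form1 u q h + form2 u q h / 2 + form3 u q h / 6 + form4 u q h / 24))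
      =o[𝓝 0] (fun h => ‖h‖ ^ 4) := by
  rw [Asymptotics.isLittleO_iff]
  intro c hc
  have hcont : ∀ i j : ℕ, ∀ᶠ p in 𝓝 q, |partialDeriv i j u p - partialDeriv i j u q| ≤ c / 16 :=
    fun i j => by
      have := ((contDiffOn_partialDeriv hU hu i j).continuousOn.continuousAt (hU.mem_nhds hq))
      filter_upwards [Metric.tendsto_nhds.1 this (c / 16) (by positivity)] with p hp
      exact hp.le
  have hall : ∀ᶠ p in 𝓝 q, p ∈ U ∧ ∀ i ∈ Finset.range 5, ∀ j ∈ Finset.range 5,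
      |partialDeriv i j u p - partialDeriv i j u q| ≤ c / 16 :=
    Filter.Eventually.and (hU.mem_nhds hq) <| (Filter.eventually_all_finset _).2
      fun i _ => (Filter.eventually_all_finset _).2 fun j _ => hcont i j
  obtain ⟨r, hr, hball⟩ := Metric.eventually_nhds_iff.1 hall
  filter_upwards [Metric.ball_mem_nhds (0 : ℝ × ℝ) hr] with h hh
  rw [mem_ball_zero_iff] at hh
  have hmem : ∀ t ∈ Set.Icc (0 : ℝ) 1, q + t • h ∈ U ∧ ∀ i ∈ Finset.range 5,
      ∀ j ∈ Finset.range 5,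
      |partialDeriv i j u (q + t • h) - partialDeriv i j u q| ≤ c / 16 := fun t ht => by
    refine hball ?_
    rw [dist_self_add_left, norm_smul, Real.norm_of_nonneg ht.1]
    exact (mul_le_of_le_one_left (norm_nonneg _) ht.2).trans_lt hh
  have := taylor_four_bound (C := c * ‖h‖ ^ 4)
    (fun t ht => hasDerivAt_form0 hU hu (hmem t ht).1)
    (fun t ht => hasDerivAt_form1 hU hu (hmem t ht).1)
    (fun t ht => hasDerivAt_form2 hU hu (hmem t ht).1)
    (fun t ht => hasDerivAt_form3 hU hu (hmem t ht).1)
    (fun t ht => by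
      have := abs_form4_sub_le (hmem t ht).2 h
      simp only [zero_smul, add_zero]
      exact this.trans_eq (by ring))
  simp only [zero_smul, add_zero, one_smul] at this
  simpa using this

/-! ### Comparing coefficients along curves in a graph -/

theorem eq_zero_of_isLittleO_pow {c : ℝ} {R : ℝ → ℝ} (hR : Continuous R) (k : ℕ)
    (h : (fun s : ℝ => s ^ k * (c + s * R s)) =o[𝓝 0] (fun s : ℝ => s ^ k)) : c = 0 := by
  have h1 := h.mono (nhdsWithin_le_nhds (s := {0}ᶜ))
  have h2 := h1.tendsto_div_nhds_zero
  have h3 : Filter.Tendsto (fun s : ℝ => c + s * R s) (𝓝[≠] 0) (𝓝 0) := by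
    refine h2.congr' ?_
    filter_upwards [self_mem_nhdsWithin] with s hs
    have hs' : s ≠ 0 := hs
    field_simp
  have h4 : Filter.Tendsto (fun s : ℝ => c + s * R s) (𝓝[≠] 0) (𝓝 (c + 0 * R 0)) :=
    (Continuous.tendsto (by fun_prop) 0).mono_left nhdsWithin_le_nhds
  simpa using tendsto_nhds_unique h4 h3

/-- The coefficients of a polynomial which is `o(s^4)` vanish up to order four. -/
theorem coeffs_eq_zero_of_isLittleO {c1 c2 c3 c4 : ℝ} {R : ℝ → ℝ} (hR : Continuous R)
    (h : (fun s : ℝ => c1 * s + c2 * s ^ 2 + c3 * s ^ 3 + c4 * s ^ 4 + s ^ 5 * R s)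
      =o[𝓝 0] (fun s : ℝ => s ^ 4)) : c1 = 0 ∧ c2 = 0 ∧ c3 = 0 ∧ c4 = 0 := by
  have mono : ∀ k : ℕ, k ≤ 4 → (fun s : ℝ => s ^ 4) =O[𝓝 0] (fun s : ℝ => s ^ k) :=
    fun k hk => Asymptotics.IsBigO.of_bound 1 (by
      filter_upwards [Metric.closedBall_mem_nhds (0 : ℝ) one_pos] with s hs
      rw [one_mul, norm_pow, norm_pow]
      exact pow_le_pow_of_le_one (norm_nonneg s) (by simpa using hs) hk)
  have e1 : c1 = 0 := by
    refine eq_zero_of_isLittleO_pow (R := fun s => c2 + c3 * s + c4 * s ^ 2 + s ^ 3 * R s)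
      (by fun_prop) 1 ((h.trans_isBigO (mono 1 (by norm_num))).congr_left fun s => ?_)
    ring
  have e2 : c2 = 0 := by
    refine eq_zero_of_isLittleO_pow (R := fun s => c3 + c4 * s + s ^ 2 * R s)
      (by fun_prop) 2 ((h.trans_isBigO (mono 2 (by norm_num))).congr_left fun s => ?_)
    rw [e1]; ring
  have e3 : c3 = 0 := by
    refine eq_zero_of_isLittleO_pow (R := fun s => c4 + s * R s)
      (by fun_prop) 3 ((h.trans_isBigO (mono 3 (by norm_num))).congr_left fun s => ?_)
    rw [e1, e2]; ring
  have e4 : c4 = 0 := by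
    refine eq_zero_of_isLittleO_pow (R := R) hR 4 (h.congr_left fun s => ?_)
    rw [e1, e2, e3]; ring
  exact ⟨e1, e2, e3, e4⟩

/-- The second differential of `u` at `q`, evaluated on `(a, b)`. -/
noncomputable def form2Polar (u : ℝ × ℝ → ℝ) (q a b : ℝ × ℝ) : ℝ :=
  partialDeriv 2 0 u q * (a.1 * b.1) + partialDeriv 1 1 u q * (a.1 * b.2 + a.2 * b.1)
    + partialDeriv 0 2 u q * (a.2 * b.2)

/-- The third differential of `u` at `q`, evaluated on `(a, a, b)`. -/
noncomputable def form3Polar (u : ℝ × ℝ → ℝ) (q a b : ℝ × ℝ) : ℝ :=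
  partialDeriv 3 0 u q * (a.1 ^ 2 * b.1)
    + partialDeriv 2 1 u q * (a.1 ^ 2 * b.2 + 2 * a.1 * a.2 * b.1)
    + partialDeriv 1 2 u q * (a.2 ^ 2 * b.1 + 2 * a.1 * a.2 * b.2)
    + partialDeriv 0 3 u q * (a.2 ^ 2 * b.2)

theorem form1_smul_add (u : ℝ × ℝ → ℝ) (q a b : ℝ × ℝ) (s t : ℝ) :
    form1 u q (s • (a + t • b)) = s * (form1 u q a + t * form1 u q b) := by
  simp only [form1, Prod.fst_add, Prod.snd_add, Prod.smul_fst, Prod.smul_snd, smul_eq_mul]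
  ring

theorem form2_smul_add (u : ℝ × ℝ → ℝ) (q a b : ℝ × ℝ) (s t : ℝ) :
    form2 u q (s • (a + t • b))
      = s ^ 2 * (form2 u q a + 2 * t * form2Polar u q a b + t ^ 2 * form2 u q b) := by
  simp only [form2, form2Polar, Prod.fst_add, Prod.snd_add, Prod.smul_fst, Prod.smul_snd,
    smul_eq_mul]
  ring

theorem form3_smul_add (u : ℝ × ℝ → ℝ) (q a b : ℝ × ℝ) (s t : ℝ) :
    form3 u q (s • (a + t • b)) = s ^ 3 * (form3 u q a + 3 * t * form3Polar u q a b
      + 3 * t ^ 2 * form3Polar u q b a + t ^ 3 * form3 u q b) := by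
  simp only [form3, form3Polar, Prod.fst_add, Prod.snd_add, Prod.smul_fst, Prod.smul_snd,
    smul_eq_mul]
  ring

/-- The fourth differential of `u` at `q`, expanded along `a + t • b`, after the term of order
zero. -/
noncomputable def form4Rest (u : ℝ × ℝ → ℝ) (q a b : ℝ × ℝ) (t : ℝ) : ℝ :=
  partialDeriv 4 0 u q * (4 * a.1 ^ 3 * b.1 + 6 * t * a.1 ^ 2 * b.1 ^ 2
      + 4 * t ^ 2 * a.1 * b.1 ^ 3 + t ^ 3 * b.1 ^ 4)
    + 4 * partialDeriv 3 1 u q * ((3 * a.1 ^ 2 * b.1 + 3 * t * a.1 * b.1 ^ 2 + t ^ 2 * b.1 ^ 3)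
      * (a.2 + t * b.2) + a.1 ^ 3 * b.2)
    + 6 * partialDeriv 2 2 u q * ((2 * a.1 * b.1 + t * b.1 ^ 2) * (a.2 + t * b.2) ^ 2
      + a.1 ^ 2 * (2 * a.2 * b.2 + t * b.2 ^ 2))
    + 4 * partialDeriv 1 3 u q * ((3 * a.2 ^ 2 * b.2 + 3 * t * a.2 * b.2 ^ 2 + t ^ 2 * b.2 ^ 3)
      * (a.1 + t * b.1) + a.2 ^ 3 * b.1)
    + partialDeriv 0 4 u q * (4 * a.2 ^ 3 * b.2 + 6 * t * a.2 ^ 2 * b.2 ^ 2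
      + 4 * t ^ 2 * a.2 * b.2 ^ 3 + t ^ 3 * b.2 ^ 4)

theorem form4_smul_add (u : ℝ × ℝ → ℝ) (q a b : ℝ × ℝ) (s t : ℝ) :
    form4 u q (s • (a + t • b)) = s ^ 4 * (form4 u q a + t * form4Rest u q a b t) := by
  simp only [form4, form4Rest, Prod.fst_add, Prod.snd_add, Prod.smul_fst, Prod.smul_snd,
    smul_eq_mul]
  ring

/-- If the graph of `u` contains the curve `s ↦ s • a + v(s) • b` (with vertical components `za`,
`zb`), based at `(q, u q)`, then the differentials of `u` at `q` satisfy the relations found by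
comparing the coefficients of `s, …, s^4`. -/
theorem jet_equations {u : ℝ × ℝ → ℝ} {U : Set (ℝ × ℝ)} (hU : IsOpen U)
    (hu : ContDiffOn ℝ ∞ u U) {q : ℝ × ℝ} (hq : q ∈ U) {a b : ℝ × ℝ} {za zb f2 f3 f4 : ℝ}
    {v : ℝ → ℝ}
    (hv : (fun s => v s - (f2 * s ^ 2 + f3 * s ^ 3 + f4 * s ^ 4)) =o[𝓝 0] (fun s : ℝ => s ^ 4))
    (heq : ∀ᶠ s in 𝓝 (0 : ℝ), u (q + s • a + v s • b) = u q + s * za + v s * zb) :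
    form1 u q a = za ∧
    form2 u q a / 2 = (zb - form1 u q b) * f2 ∧
    form3 u q a / 6 = (zb - form1 u q b) * f3 - form2Polar u q a b * f2 ∧
    form4 u q a / 24 = (zb - form1 u q b) * f4 - form2Polar u q a b * f3
      - form2 u q b / 2 * f2 ^ 2 - form3Polar u q a b / 2 * f2 := by
  set v0 : ℝ → ℝ := fun s => f2 * s ^ 2 + f3 * s ^ 3 + f4 * s ^ 4 with hv0
  set k : ℝ → ℝ := fun s => f2 + f3 * s + f4 * s ^ 2 with hk
  have hkc : Continuous k := by fun_prop
  have hv0c : Continuous v0 := by fun_prop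
  set h0 : ℝ → ℝ × ℝ := fun s => s • a + v0 s • b with hh0
  have hh0c : Continuous h0 := by fun_prop
  have hh00 : h0 0 = 0 := by simp [hh0, hv0]
  have hvt : Filter.Tendsto v (𝓝 0) (𝓝 0) := by
    have h1 : Filter.Tendsto (fun s => v s - v0 s) (𝓝 0) (𝓝 0) :=
      hv.trans_tendsto (by simpa using (continuous_pow (M := ℝ) 4).tendsto 0)
    have h2 := h1.add (hv0c.tendsto 0)
    simpa [hv0] using h2
  have hstrict : HasStrictFDerivAt u (fderiv ℝ u q) q :=
    (hu.contDiffAt (hU.mem_nhds hq)).hasStrictFDerivAt (by simp)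
  have hlip := hstrict.isBigO_sub
  have t1 : Filter.Tendsto (fun s => (q + h0 s, q + s • a + v s • b)) (𝓝 0) (𝓝 (q, q)) := by
    refine Filter.Tendsto.prodMk_nhds ?_ ?_
    · simpa [hh00] using (Continuous.tendsto (by fun_prop) 0 :
        Filter.Tendsto (fun s => q + h0 s) (𝓝 0) (𝓝 (q + h0 0)))
    · have h1 : Filter.Tendsto (fun s : ℝ => q + s • a) (𝓝 0) (𝓝 (q + (0 : ℝ) • a)) :=
        Continuous.tendsto (by fun_prop) 0
      simpa using h1.add (hvt.smul_const b)
  -- The function `v` equals the polynomial `v0` only up to `o(s^4)`. Strict differentiability makes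
  -- `u` Lipschitz near `q`, so exchanging one for the other costs `o(s^4)`.
  have s1 : (fun s => u (q + h0 s) - u (q + s • a + v s • b)) =o[𝓝 0] (fun s : ℝ => s ^ 4) := by
    refine (hlip.comp_tendsto t1).trans_isLittleO ?_
    have : (fun s => (v0 s - v s) • b) =o[𝓝 0] (fun s : ℝ => s ^ 4) := by
      have h1 : (fun s => v0 s - v s) =o[𝓝 0] (fun s : ℝ => s ^ 4) :=
        hv.neg_left.congr_left fun s => by ring
      have h2 := h1.smul_isBigO (Asymptotics.isBigO_refl (fun _ : ℝ => b) (𝓝 0))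
      refine h2.trans_isBigO ?_
      refine Asymptotics.IsBigO.of_bound ‖b‖ (Filter.Eventually.of_forall fun s => ?_)
      rw [norm_smul, mul_comm]
    refine this.congr_left fun s => ?_
    simp only [Function.comp, hh0, sub_smul]
    abel
  have s2 : (fun s => u (q + h0 s) - (u q + form1 u q (h0 s) + form2 u q (h0 s) / 2
      + form3 u q (h0 s) / 6 + form4 u q (h0 s) / 24)) =o[𝓝 0] (fun s : ℝ => s ^ 4) := by
    have t2 : Filter.Tendsto h0 (𝓝 0) (𝓝 0) := by
      simpa [hh00] using hh0c.tendsto 0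
    refine ((taylor_four hU hu hq).comp_tendsto t2).trans_isBigO ?_
    have b1 : h0 =O[𝓝 0] (fun s : ℝ => s) := by
      have h1 : (fun s => a + (s * k s) • b) =O[𝓝 0] (fun _ : ℝ => (1 : ℝ)) :=
        (Continuous.tendsto (by fun_prop) 0 : Filter.Tendsto (fun s => a + (s * k s) • b) (𝓝 0)
          (𝓝 _)).isBigO_one ℝ
      have h2 := (Asymptotics.isBigO_refl (fun s : ℝ => s) (𝓝 0)).smul h1
      refine (h2.congr_left fun s => ?_).congr_right fun s => by simp
      simp only [hh0, hv0, hk, smul_add, smul_smul]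
      congr 2
      ring
    exact b1.norm_left.pow 4
  have s3 : (fun s => form1 u q (h0 s) + form2 u q (h0 s) / 2 + form3 u q (h0 s) / 6
      + form4 u q (h0 s) / 24 - (s * za + v0 s * zb)) =o[𝓝 0] (fun s : ℝ => s ^ 4) := by
    have h3 : (fun s => (v s - v0 s) * zb) =o[𝓝 0] (fun s : ℝ => s ^ 4) := by
      simpa [mul_comm] using hv.const_mul_left zb
    refine ((s1.sub s2).add h3).congr' ?_ Filter.EventuallyEq.rfl
    filter_upwards [heq] with s hs
    rw [hs]; ring
  have := coeffs_eq_zero_of_isLittleO (c1 := form1 u q a - za)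
    (c2 := form2 u q a / 2 - (zb - form1 u q b) * f2)
    (c3 := form3 u q a / 6 - ((zb - form1 u q b) * f3 - form2Polar u q a b * f2))
    (c4 := form4 u q a / 24 - ((zb - form1 u q b) * f4 - form2Polar u q a b * f3
      - form2 u q b / 2 * f2 ^ 2 - form3Polar u q a b / 2 * f2))
    -- With `v0 s = s ^ 2 * k s`, these are all the terms of order at least five, divided by `s ^
    -- 5`.
    (R := fun s => form2Polar u q a b * f4
      + form2 u q b / 2 * (f3 * (f2 + k s) + f4 * s * (f2 + k s))
      + form3Polar u q a b / 2 * (f3 + f4 * s)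
      + (3 * k s ^ 2 * form3Polar u q b a + s * k s ^ 3 * form3 u q b) / 6
      + k s * form4Rest u q a b (s * k s) / 24)
    (by simp only [form4Rest]; fun_prop) (s3.congr_left fun s => ?_)
  · exact ⟨sub_eq_zero.1 this.1, sub_eq_zero.1 this.2.1, sub_eq_zero.1 this.2.2.1,
      sub_eq_zero.1 this.2.2.2⟩
  · have e : h0 s = s • (a + (s * k s) • b) := by
      simp only [hh0, hv0, hk, smul_add, smul_smul]
      congr 2
      ring
    have e0 : v0 s = s ^ 2 * k s := by simp only [hv0, hk]; ring
    have ek : k s = f2 + f3 * s + f4 * s ^ 2 := rfl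
    rw [e, form1_smul_add, form2_smul_add, form3_smul_add, form4_smul_add, e0]
    generalize form4Rest u q a b (s * k s) = r
    rw [ek]
    ring

/-! ### Frames and the differentials they prescribe -/

/-- The Euclidean scalar product of the plane. -/
def dot (w l : ℝ × ℝ) : ℝ := w.1 * l.1 + w.2 * l.2

/-- The derivative of the standard cubic at `w` in the direction `l`. -/
noncomputable def cubicPartDeriv (w l : ℝ × ℝ) : ℝ :=
  (w.1 ^ 2 - w.2 ^ 2) / 2 * l.1 - w.1 * w.2 * l.2

/-- A frame `e` consists of a scale `e 0`, a linear map of the plane with the entries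
`e 1, …, e 4`, and a vector `(e 5, e 6)`. This is the linear map. -/
def frameMap (e : Fin 7 → ℝ) (h : ℝ × ℝ) : ℝ × ℝ :=
  (e 1 * h.1 + e 2 * h.2, e 3 * h.1 + e 4 * h.2)

/-- The vector which belongs to a frame. -/
def frameVec (e : Fin 7 → ℝ) : ℝ × ℝ := (e 5, e 6)

/-- The second differential of a surface which is standard in the frame `e`. -/
noncomputable def model2 (e : Fin 7 → ℝ) (h : ℝ × ℝ) : ℝ :=
  2 * e 0 * quadraticPart (frameMap e h)

/-- The third differential of a surface which is standard in the frame `e`. -/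
noncomputable def model3 (e : Fin 7 → ℝ) (h : ℝ × ℝ) : ℝ :=
  6 * e 0 * (cubicPart (frameMap e h)
    - dot (frameMap e h) (frameVec e) * quadraticPart (frameMap e h))

/-- The fourth differential of a surface with the quartic part `f` in the frame `e`. -/
noncomputable def model4 (f : ℝ × ℝ → ℝ) (e : Fin 7 → ℝ) (h : ℝ × ℝ) : ℝ :=
  24 * e 0 * (f (frameMap e h) - dot (frameMap e h) (frameVec e) * cubicPart (frameMap e h)
    - quadraticPart (frameMap e h) * cubicPartDeriv (frameMap e h) (frameVec e)
    + dot (frameVec e) (frameVec e) / 2 * quadraticPart (frameMap e h) ^ 2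
    + dot (frameMap e h) (frameVec e) ^ 2 * quadraticPart (frameMap e h))

theorem form2Polar_eq (u : ℝ × ℝ → ℝ) (q a b : ℝ × ℝ) :
    form2Polar u q a b = (form2 u q (a + b) - form2 u q a - form2 u q b) / 2 := by
  simp only [form2, form2Polar, Prod.fst_add, Prod.snd_add]
  ring

theorem form3Polar_eq (u : ℝ × ℝ → ℝ) (q a b : ℝ × ℝ) :
    form3Polar u q a b = (form3 u q (a + b) - form3 u q (a - b) - 2 * form3 u q b) / 6 := by
  simp only [form3, form3Polar, Prod.fst_add, Prod.snd_add, Prod.fst_sub, Prod.snd_sub]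
  ring

/-- The relations of `jet_equations`, solved for the differentials of `u`. -/
theorem exists_frame_of_relations {u : ℝ × ℝ → ℝ} {q b : ℝ × ℝ} {κ : ℝ} {f : ℝ × ℝ → ℝ}
    (A : (ℝ × ℝ) →ₗ[ℝ] (ℝ × ℝ)) (hA : Function.Injective A)
    (h2 : ∀ w, form2 u q (A w) / 2 = κ * quadraticPart w)
    (h3 : ∀ w, form3 u q (A w) / 6
      = κ * cubicPart w - form2Polar u q (A w) b * quadraticPart w)
    (h4 : ∀ w, form4 u q (A w) / 24 = κ * f w - form2Polar u q (A w) b * cubicPart w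
      - form2 u q b / 2 * quadraticPart w ^ 2 - form3Polar u q (A w) b / 2 * quadraticPart w) :
    ∃ e : Fin 7 → ℝ, (∀ h, form2 u q h = model2 e h) ∧ (∀ h, form3 u q h = model3 e h) ∧
      ∀ h, form4 u q h = model4 f e h := by
  set E := LinearEquiv.ofInjectiveEndo A hA with hE
  set l : ℝ × ℝ := E.symm b with hl
  have hAl : A l = b := E.apply_symm_apply b
  have p2 : ∀ w, form2Polar u q (A w) b = κ * dot w l := fun w => by
    have e1 := h2 (w + l)
    have e2 := h2 w
    have e3 := h2 l
    rw [form2Polar_eq, ← hAl, ← map_add]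
    have : quadraticPart (w + l) = quadraticPart w + quadraticPart l + dot w l := by
      simp only [quadraticPart, dot, Prod.fst_add, Prod.snd_add]; ring
    rw [this] at e1
    linear_combination e1 - e2 - e3
  have k3 : ∀ w, form3 u q (A w) / 6 = κ * (cubicPart w - dot w l * quadraticPart w) :=
    fun w => by rw [h3, p2]; ring
  have p3 : ∀ w, form3Polar u q (A w) b / 2 = κ * (cubicPartDeriv w l
      - dot l l * quadraticPart w - dot w l ^ 2) := fun w => by
    have e1 := k3 (w + l)
    have e2 := k3 (w - l)
    have e3 := k3 l
    rw [form3Polar_eq, ← hAl, ← map_add, ← map_sub]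
    have : cubicPart (w + l) - dot (w + l) l * quadraticPart (w + l)
        - (cubicPart (w - l) - dot (w - l) l * quadraticPart (w - l))
        - 2 * (cubicPart l - dot l l * quadraticPart l)
        = 2 * (cubicPartDeriv w l - dot l l * quadraticPart w - dot w l ^ 2) := by
      simp only [cubicPart, cubicPartDeriv, quadraticPart, dot, Prod.fst_add, Prod.snd_add,
        Prod.fst_sub, Prod.snd_sub]
      ring
    linear_combination (e1 - e2 - 2 * e3 + κ * this) / 2
  have b2 : form2 u q b / 2 = κ * quadraticPart l := by rw [← hAl, h2]
  -- The linear part is the matrix of the inverse of `A`, so that `frameMap e` undoes `A`.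
  refine ⟨![κ, (E.symm (1, 0)).1, (E.symm (0, 1)).1, (E.symm (1, 0)).2, (E.symm (0, 1)).2,
    l.1, l.2], ?_⟩
  set e : Fin 7 → ℝ := ![κ, (E.symm (1, 0)).1, (E.symm (0, 1)).1, (E.symm (1, 0)).2,
    (E.symm (0, 1)).2, l.1, l.2] with he
  have e0 : e 0 = κ := rfl
  have ev : frameVec e = l := rfl
  have eA : ∀ h, A (frameMap e h) = h := fun h => by
    have : frameMap e h = E.symm h := by
      conv_rhs => rw [show h = h.1 • ((1 : ℝ), (0 : ℝ)) + h.2 • ((0 : ℝ), (1 : ℝ)) by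
        ext <;> simp]
      rw [map_add, map_smul, map_smul]
      ext <;> simp [frameMap, he] <;> ring
    rw [this]
    exact E.apply_symm_apply h
  refine ⟨fun h => ?_, fun h => ?_, fun h => ?_⟩
  · have := h2 (frameMap e h)
    rw [eA] at this
    rw [model2, e0]
    linear_combination 2 * this
  · have := k3 (frameMap e h)
    rw [eA] at this
    rw [model3, e0, ev]
    linear_combination 6 * this
  · have := h4 (frameMap e h)
    rw [p2, p3, b2, eA] at this
    rw [model4, e0, ev]
    have hd : quadraticPart l = dot l l / 2 := by simp only [quadraticPart, dot]; ring
    rw [hd] at this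
    linear_combination 24 * this

/-! ### Uniqueness of frames up to the symmetry group of the cubic -/

/-- The orthogonal map of the plane with the first column `(a, c)` and the determinant `σ`. -/
def orthMap (m : ℝ × ℝ × ℝ) (w : ℝ × ℝ) : ℝ × ℝ :=
  (m.1 * w.1 - m.2.2 * m.2.1 * w.2, m.2.1 * w.1 + m.2.2 * m.1 * w.2)

/-- A finite set of linear maps which contains the symmetry group `D_3` of the standard cubic. -/
noncomputable def symmetryCandidates : Finset (ℝ × ℝ × ℝ) :=
  ({1, -1 / 2} : Finset ℝ) ×ˢ ({0, √3 / 2, -(√3 / 2)} : Finset ℝ) ×ˢ ({1, -1} : Finset ℝ)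

/-- For `z = a + i c` the equations say `z ^ 3 = |z| ^ 2`. As `z ≠ 0`, this forces `|z| = 1`, and
`z` is a cube root of unity. -/
theorem mem_symmetryCandidates {a c σ : ℝ} (hr : a ^ 2 + c ^ 2 ≠ 0)
    (h1 : a ^ 3 - 3 * a * c ^ 2 = a ^ 2 + c ^ 2) (h2 : 3 * a ^ 2 * c - c ^ 3 = 0)
    (hσ : σ = 1 ∨ σ = -1) : (a, c, σ) ∈ symmetryCandidates ∧ a ^ 2 + c ^ 2 = 1 := by
  have hc : c = 0 ∨ 3 * a ^ 2 - c ^ 2 = 0 := by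
    rw [← mul_eq_zero]; linear_combination h2
  rcases hc with rfl | hc
  · have ha : a = 1 := by
      have ha0 : a ^ 2 ≠ 0 := by simpa using hr
      refine mul_left_cancel₀ ha0 ?_
      linear_combination h1
    subst ha
    refine ⟨?_, by norm_num⟩
    rcases hσ with rfl | rfl <;> simp [symmetryCandidates]
  · have hc' : c ^ 2 = 3 * a ^ 2 := by linarith
    have ha : a = -1 / 2 := by
      have ha0 : a ^ 2 ≠ 0 := fun h => hr (by rw [hc', h]; norm_num)
      refine mul_left_cancel₀ ha0 ?_
      rw [hc'] at h1
      linear_combination -h1 / 8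
    subst ha
    have hs : √3 ^ 2 = 3 := Real.sq_sqrt (by norm_num)
    have hc2 : c = √3 / 2 ∨ c = -(√3 / 2) := by
      rw [← sq_eq_sq_iff_eq_or_eq_neg]
      rw [hc']; linear_combination -hs / 4
    refine ⟨?_, by rw [hc']; norm_num⟩
    rcases hσ with rfl | rfl <;> rcases hc2 with rfl | rfl <;> simp [symmetryCandidates]

/-- Two frames with the same standard 3-jet differ by a symmetry of the standard cubic. -/
theorem exists_symmetry {e e' : Fin 7 → ℝ} (h0 : e 0 ≠ 0) (hdet : e 1 * e 4 - e 2 * e 3 ≠ 0)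
    (h2 : ∀ h, model2 e h = model2 e' h) (h3 : ∀ h, model3 e h = model3 e' h) :
    ∃ m ∈ symmetryCandidates, ∀ (f : ℝ × ℝ → ℝ) (h : ℝ × ℝ),
      model4 f e' h = model4 (f ∘ orthMap m) e h := by
  obtain ⟨D, hD⟩ : ∃ D, D = e 1 * e 4 - e 2 * e 3 := ⟨_, rfl⟩
  rw [← hD] at hdet
  obtain ⟨m1, m2, m3, m4, hM⟩ : ∃ m1 m2 m3 m4 : ℝ, ∀ h, frameMap e' h
      = (m1 * (frameMap e h).1 + m2 * (frameMap e h).2,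
        m3 * (frameMap e h).1 + m4 * (frameMap e h).2) := by
    -- The entries of the matrix of `e'` times the inverse of the matrix of `e`.
    refine ⟨(e' 1 * e 4 - e' 2 * e 3) / D, (e' 2 * e 1 - e' 1 * e 2) / D,
      (e' 3 * e 4 - e' 4 * e 3) / D, (e' 4 * e 1 - e' 3 * e 2) / D, fun h => ?_⟩
    simp only [frameMap]
    ext <;> simp only <;> field_simp <;> rw [hD] <;> ring
  have hsurj : ∀ w, ∃ h, frameMap e h = w := fun w => by
    refine ⟨((e 4 * w.1 - e 2 * w.2) / D, (e 1 * w.2 - e 3 * w.1) / D), ?_⟩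
    simp only [frameMap]
    ext <;> simp only <;> field_simp <;> rw [hD] <;> ring
  have k2 : ∀ w : ℝ × ℝ, e 0 * (w.1 ^ 2 + w.2 ^ 2)
      = e' 0 * ((m1 * w.1 + m2 * w.2) ^ 2 + (m3 * w.1 + m4 * w.2) ^ 2) := fun w => by
    obtain ⟨h, rfl⟩ := hsurj w
    have := h2 h
    simp only [model2, hM, quadraticPart] at this
    linear_combination this
  have k3 : ∀ w : ℝ × ℝ, 6 * e 0 * (cubicPart w - dot w (frameVec e) * quadraticPart w)
      = 6 * e' 0 * (cubicPart (m1 * w.1 + m2 * w.2, m3 * w.1 + m4 * w.2)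
        - dot (m1 * w.1 + m2 * w.2, m3 * w.1 + m4 * w.2) (frameVec e')
        * quadraticPart (m1 * w.1 + m2 * w.2, m3 * w.1 + m4 * w.2)) := fun w => by
    obtain ⟨h, rfl⟩ := hsurj w
    have := h3 h
    simp only [model3, hM] at this
    exact this
  -- Three values determine a binary quadratic form and four a binary cubic form.
  have a1 := k2 (1, 0)
  have a2 := k2 (0, 1)
  have a3 := k2 (1, 1)
  have c1 := k3 (1, 0)
  have c2 := k3 (0, 1)
  have c3 := k3 (1, 1)
  have c4 := k3 (1, -1)
  simp only [cubicPart, quadraticPart, dot, frameVec] at a1 a2 a3 c1 c2 c3 c4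
  have h0' : e' 0 ≠ 0 := fun h => h0 (by rw [h] at a1; linear_combination a1)
  have o1 : m1 ^ 2 + m3 ^ 2 = m2 ^ 2 + m4 ^ 2 := by
    refine mul_left_cancel₀ h0' ?_; linear_combination a2 - a1
  have o2 : m1 * m2 + m3 * m4 = 0 := by
    refine mul_left_cancel₀ h0' ?_; linear_combination (a1 + a2 - a3) / 2
  have hr : m1 ^ 2 + m3 ^ 2 ≠ 0 := fun h => h0 (by linear_combination a1 + e' 0 * h)
  have hκ : e 0 = e' 0 * (m1 ^ 2 + m3 ^ 2) := by linear_combination a1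
  -- The columns are orthogonal and of equal length, so the matrix is a multiple of an orthogonal
  -- one, with `σ` the sign of its determinant.
  obtain ⟨σ, hσ, rfl, rfl⟩ : ∃ σ : ℝ, (σ = 1 ∨ σ = -1) ∧ m2 = -(σ * m3) ∧ m4 = σ * m1 := by
    refine ⟨(m1 * m4 - m3 * m2) / (m1 ^ 2 + m3 ^ 2), ?_, ?_, ?_⟩
    · rw [← sq_eq_one_iff, div_pow, div_eq_one_iff_eq (pow_ne_zero 2 hr)]
      linear_combination -(m1 * m2 + m3 * m4) * o2 - (m1 ^ 2 + m3 ^ 2) * o1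
    · field_simp
      linear_combination m1 * o2
    · field_simp
      linear_combination m3 * o2
  have hσ2 : σ ^ 2 = 1 := sq_eq_one_iff.2 hσ
  rw [hκ] at c1 c2 c3 c4
  -- The standard cubic is harmonic, and so is its image under a conformal map. The Laplacian of the
  -- cubic identity thus retains only the product of linear form and quadratic part, which compares
  -- the frame vectors; the harmonic part yields `hP` and `hN`.
  have d1 : e 5 = m1 * e' 5 + m3 * e' 6 := by
    refine mul_left_cancel₀ (mul_ne_zero h0' hr) ?_
    rcases hσ with rfl | rfl <;> linear_combination -(2 * c1 + (c3 + c4) / 2) / 12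
  have d2 : e 6 = σ * (-m3 * e' 5 + m1 * e' 6) := by
    refine mul_left_cancel₀ (mul_ne_zero h0' hr) ?_
    rcases hσ with rfl | rfl <;> linear_combination -(2 * c2 + (c3 - c4) / 2) / 12
  have hP : m1 ^ 3 - 3 * m1 * m3 ^ 2 = m1 ^ 2 + m3 ^ 2 := by
    refine mul_left_cancel₀ h0' ?_
    rcases hσ with rfl | rfl <;> linear_combination ((c3 + c4) / 2 - 2 * c1) / 4
  have hN : 3 * m1 ^ 2 * m3 - m3 ^ 3 = 0 := by
    refine mul_left_cancel₀ h0' ?_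
    rcases hσ with rfl | rfl
    · linear_combination ((c3 - c4) / 2 - 2 * c2) / 4
    · linear_combination -((c3 - c4) / 2 - 2 * c2) / 4
  obtain ⟨hmem, hone⟩ := mem_symmetryCandidates hr hP hN hσ
  refine ⟨_, hmem, fun f h => ?_⟩
  rw [hone] at hP
  rw [hone, mul_one] at hκ
  have hMo : frameMap e' h = orthMap (m1, m3, σ) (frameMap e h) := by
    rw [hM]; simp only [orthMap]; ext <;> simp only <;> ring
  have hv : frameVec e' = orthMap (m1, m3, σ) (frameVec e) := by
    simp only [orthMap, frameVec, d1, d2]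
    ext <;> dsimp only
    · linear_combination -e' 5 * hone + (m1 * m3 * e' 6 - m3 ^ 2 * e' 5) * hσ2
    · linear_combination -e' 6 * hone + (m1 * m3 * e' 5 - m1 ^ 2 * e' 6) * hσ2
  simp only [model4, hMo, hv, ← hκ, Function.comp]
  generalize frameMap e h = w
  generalize frameVec e = l
  have q1 : ∀ x y, dot (orthMap (m1, m3, σ) x) (orthMap (m1, m3, σ) y) = dot x y := fun x y => by
    simp only [dot, orthMap]
    linear_combination (x.1 * y.1 + σ ^ 2 * x.2 * y.2) * hone + x.2 * y.2 * hσ2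
  have q2 : quadraticPart (orthMap (m1, m3, σ) w) = quadraticPart w := by
    have := q1 w w
    simp only [dot, quadraticPart] at this ⊢
    linear_combination this / 2
  have q3 : cubicPart (orthMap (m1, m3, σ) w) = cubicPart w := by
    simp only [cubicPart, orthMap]
    rcases hσ with rfl | rfl
    · linear_combination (w.1 ^ 3 - 3 * w.1 * w.2 ^ 2) / 6 * hP
        + (w.2 ^ 3 - 3 * w.1 ^ 2 * w.2) / 6 * hN
    · linear_combination (w.1 ^ 3 - 3 * w.1 * w.2 ^ 2) / 6 * hP
        - (w.2 ^ 3 - 3 * w.1 ^ 2 * w.2) / 6 * hN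
  have q4 : cubicPartDeriv (orthMap (m1, m3, σ) w) (orthMap (m1, m3, σ) l)
      = cubicPartDeriv w l := by
    simp only [cubicPartDeriv, orthMap]
    rcases hσ with rfl | rfl
    · linear_combination ((w.1 ^ 2 - w.2 ^ 2) / 2 * l.1 - w.1 * w.2 * l.2) * hP
        + ((w.2 ^ 2 - w.1 ^ 2) / 2 * l.2 - w.1 * w.2 * l.1) * hN
    · linear_combination ((w.1 ^ 2 - w.2 ^ 2) / 2 * l.1 - w.1 * w.2 * l.2) * hP
        - ((w.2 ^ 2 - w.1 ^ 2) / 2 * l.2 - w.1 * w.2 * l.1) * hN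
  rw [q1, q1, q2, q3, q4]

/-! ### From curvatures at a point to a frame -/

theorem norm_smul_pair (s : ℝ) (w : ℝ × ℝ) : ‖(s * w.1, s * w.2)‖ = |s| * ‖w‖ := by
  rw [← Real.norm_eq_abs, ← norm_smul]; rfl

theorem tendsto_line (w : ℝ × ℝ) :
    Filter.Tendsto (fun s : ℝ => (s * w.1, s * w.2)) (𝓝 0) (𝓝 (0, 0)) := by
  have : Filter.Tendsto (fun s : ℝ => (s * w.1, s * w.2)) (𝓝 0) (𝓝 (0 * w.1, 0 * w.2)) :=
    Continuous.tendsto (by fun_prop) 0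
  simpa using this

theorem isLittleO_line {v : ℝ × ℝ → ℝ} {I40 I31 I22 I13 I04 : ℝ}
    (hjet : (fun q => v q - (quadraticPart q + cubicPart q + quarticPart I40 I31 I22 I13 I04 q))
      =o[𝓝 (0, 0)] (fun q => ‖q‖ ^ 4)) (w : ℝ × ℝ) :
    (fun s : ℝ => v (s * w.1, s * w.2) - (quadraticPart w * s ^ 2 + cubicPart w * s ^ 3
      + quarticPart I40 I31 I22 I13 I04 w * s ^ 4)) =o[𝓝 0] (fun s : ℝ => s ^ 4) := by
  refine ((hjet.comp_tendsto (tendsto_line w)).congr_left fun s => ?_).trans_isBigO ?_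
  · simp only [Function.comp, quadraticPart, cubicPart, quarticPart]; ring
  · refine Asymptotics.IsBigO.of_bound (‖w‖ ^ 4) (Filter.Eventually.of_forall fun s => ?_)
    simp only [Function.comp, norm_smul_pair, norm_pow, Real.norm_eq_abs, abs_mul, abs_abs,
      abs_norm]
    exact le_of_eq (by ring)

/-- At a point of the graph of `u` which has the curvatures `I40, …, I04`, the differentials of `u`
up to order four are standard in some frame. -/
theorem exists_frame_of_hasCurvaturesAt {S : Set A3} {T : A3 ≃ᵃ[ℝ] A3} {u : ℝ × ℝ → ℝ}
    {I40 I31 I22 I13 I04 : ℝ} {U : Set (ℝ × ℝ)} (hU : IsOpen U) (hu : ContDiffOn ℝ ∞ u U)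
    {V : Set A3} (hV : IsOpen V) (hgraph : ∀ w ∈ V, (w ∈ S ↔ T w 2 = u (T w 0, T w 1)))
    {q : ℝ × ℝ} (hq : q ∈ U) (hqV : T.symm ![q.1, q.2, u q] ∈ V)
    (hI : HasCurvaturesAt S (T.symm ![q.1, q.2, u q]) I40 I31 I22 I13 I04) :
    ∃ e : Fin 7 → ℝ, (∀ h, form2 u q h = model2 e h) ∧ (∀ h, form3 u q h = model3 e h) ∧
      ∀ h, form4 u q h = model4 (quarticPart I40 I31 I22 I13 I04) e h := by
  obtain ⟨T', v, ⟨hbase, -, V', hV', hpV', hgraph'⟩, hjet⟩ := hI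
  set p : A3 := T.symm ![q.1, q.2, u q] with hp
  set τ : A3 ≃ᵃ[ℝ] A3 := T'.symm.trans T with hτ
  have hsymm0 : T'.symm 0 = p := by rw [← hbase, AffineEquiv.symm_apply_apply]
  have hτ0 : τ 0 = ![q.1, q.2, u q] := by
    rw [hτ, AffineEquiv.trans_apply, hsymm0, hp, AffineEquiv.apply_symm_apply]
  set e1 : A3 := τ.linear ![1, 0, 0] with he1
  set e2 : A3 := τ.linear ![0, 1, 0] with he2
  set e3 : A3 := τ.linear ![0, 0, 1] with he3
  have hlin : ∀ x y z : ℝ, τ.linear ![x, y, z] = x • e1 + y • e2 + z • e3 := fun x y z => by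
    rw [he1, he2, he3, ← map_smul, ← map_smul, ← map_smul, ← map_add, ← map_add]
    congr 1
    ext i; fin_cases i <;> simp
  have hτa : ∀ x y z : ℝ, τ ![x, y, z] = ![q.1, q.2, u q] + (x • e1 + y • e2 + z • e3) :=
    fun x y z => by
      have := τ.map_vadd (0 : A3) ![x, y, z]
      simp only [vadd_eq_add, add_zero] at this
      rw [this, hτ0, hlin, add_comm]
  set b : ℝ × ℝ := (e3 0, e3 1) with hb
  set A : (ℝ × ℝ) →ₗ[ℝ] (ℝ × ℝ) := (LinearMap.fst ℝ ℝ ℝ).smulRight (e1 0, e1 1)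
    + (LinearMap.snd ℝ ℝ ℝ).smulRight (e2 0, e2 1) with hAdef
  have hA : ∀ w : ℝ × ℝ, A w = (w.1 * e1 0 + w.2 * e2 0, w.1 * e1 1 + w.2 * e2 1) :=
    fun w => by simp [hAdef]
  have hvt : Filter.Tendsto v (𝓝 (0, 0)) (𝓝 0) := by
    have h1 : Filter.Tendsto (fun w : ℝ × ℝ => ‖w‖ ^ 4) (𝓝 (0, 0)) (𝓝 (‖((0 : ℝ), (0 : ℝ))‖ ^ 4)) :=
      Continuous.tendsto (by fun_prop) _
    have h2 := hjet.trans_tendsto (by simpa using h1)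
    have h3 : Filter.Tendsto (fun w : ℝ × ℝ => quadraticPart w + cubicPart w
        + quarticPart I40 I31 I22 I13 I04 w) (𝓝 (0, 0)) (𝓝 (quadraticPart (0, 0) + cubicPart (0, 0)
        + quarticPart I40 I31 I22 I13 I04 (0, 0))) :=
      Continuous.tendsto (by unfold quadraticPart cubicPart quarticPart; fun_prop) _
    simpa [quadraticPart, cubicPart, quarticPart] using h2.add h3
  have hTc' : Continuous T'.symm := T'.symm.toAffineMap.continuous_of_finiteDimensional
  -- The curve over the line through `w` in the normalizing coordinates lies on `S`. In the
  -- coordinates `T` it is `s • A w + v • b` above `q`, and it lies on the graph of `u`.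
  have key : ∀ w : ℝ × ℝ, _ := fun w => jet_equations hU hu hq (a := A w) (b := b)
    (za := w.1 * e1 2 + w.2 * e2 2) (zb := e3 2) (f2 := quadraticPart w) (f3 := cubicPart w)
    (f4 := quarticPart I40 I31 I22 I13 I04 w) (v := fun s => v (s * w.1, s * w.2))
    (isLittleO_line hjet w) (by
      have hpt : Filter.Tendsto (fun s : ℝ => T'.symm ![s * w.1, s * w.2, v (s * w.1, s * w.2)])
          (𝓝 0) (𝓝 p) := by
        rw [← hsymm0]
        refine (hTc'.tendsto 0).comp (tendsto_pi_nhds.2 fun i => ?_)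
        fin_cases i
        · exact (continuous_fst.tendsto _).comp (tendsto_line w)
        · exact (continuous_snd.tendsto _).comp (tendsto_line w)
        · exact hvt.comp (tendsto_line w)
      filter_upwards [hpt (hV.mem_nhds hqV), hpt (hV'.mem_nhds hpV')] with s hs hs'
      have h1 := (hgraph _ hs).1 ((hgraph' _ hs').2 (by
        rw [AffineEquiv.apply_symm_apply]; simp))
      have h2 : T (T'.symm ![s * w.1, s * w.2, v (s * w.1, s * w.2)])
          = ![q.1, q.2, u q] + ((s * w.1) • e1 + (s * w.2) • e2 + v (s * w.1, s * w.2) • e3) :=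
        hτa _ _ _
      rw [h2] at h1
      simp only [Pi.add_apply, Pi.smul_apply, smul_eq_mul, Matrix.cons_val] at h1
      rw [show q + s • A w + v (s * w.1, s * w.2) • b
        = (q.1 + (s * w.1 * e1 0 + s * w.2 * e2 0 + v (s * w.1, s * w.2) * e3 0),
          q.2 + (s * w.1 * e1 1 + s * w.2 * e2 1 + v (s * w.1, s * w.2) * e3 1)) by
        rw [hA, hb]
        ext <;> simp <;> ring, ← h1]
      ring)
  have hform1 : ∀ w, form1 u q (A w) = w.1 * e1 2 + w.2 * e2 2 := fun w => (key w).1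
  obtain ⟨κ, hκ⟩ : ∃ κ, κ = e3 2 - form1 u q b := ⟨_, rfl⟩
  -- If `A w` vanishes, the first order relation makes the vertical component vanish as well, so the
  -- invertible linear part of `τ` kills `(w, 0)`.
  have hker : ∀ w, A w = 0 → w = 0 := fun w hw => by
    have h1 := hform1 w
    rw [hw] at h1
    have h1' : w.1 * e1 2 + w.2 * e2 2 = 0 := by rw [← h1]; simp [form1]
    rw [hA, Prod.mk_eq_zero] at hw
    have : τ.linear ![w.1, w.2, 0] = 0 := by
      rw [hlin]
      ext i; fin_cases i
      · simpa using hw.1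
      · simpa using hw.2
      · simpa using h1'
    have h3 := (LinearEquiv.map_eq_zero_iff _).1 this
    have c0 := congrFun h3 0
    have c1 := congrFun h3 1
    ext
    · simpa using c0
    · simpa using c1
  refine exists_frame_of_relations (b := b) (κ := κ) A
    ((injective_iff_map_eq_zero A).2 hker) (fun w => ?_) (fun w => ?_) (fun w => ?_)
  · rw [hκ]; exact (key w).2.1
  · rw [hκ]; exact (key w).2.2.1
  · rw [hκ]; exact (key w).2.2.2

/-! ### Local inversion of the map from frames to 3-jets -/

/-- The second and third partial derivatives of `u` at `q`. -/
noncomputable def jet (u : ℝ × ℝ → ℝ) (q : ℝ × ℝ) : Fin 7 → ℝ :=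
  ![partialDeriv 2 0 u q, partialDeriv 1 1 u q, partialDeriv 0 2 u q, partialDeriv 3 0 u q,
    partialDeriv 2 1 u q, partialDeriv 1 2 u q, partialDeriv 0 3 u q]

/-- The second and third partial derivatives of a surface which is standard in the frame `e`. -/
noncomputable def frameJet (e : Fin 7 → ℝ) : Fin 7 → ℝ :=
  ![model2 e (1, 0), (model2 e (1, 1) - model2 e (1, 0) - model2 e (0, 1)) / 2, model2 e (0, 1),
    model3 e (1, 0), (model3 e (1, 1) - model3 e (1, -1) - 2 * model3 e (0, 1)) / 6,
    (model3 e (1, 1) + model3 e (1, -1) - 2 * model3 e (1, 0)) / 6, model3 e (0, 1)]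

/-- The coefficients of a binary quartic form. -/
noncomputable def quarticCoeffs (m : ℝ × ℝ → ℝ) : Fin 5 → ℝ :=
  ![m (1, 0),
    (m (2, 1) - 12 * m (1, 0) + 3 * m (0, 1) - 3 * m (1, 1) - m (1, -1)) / 24,
    (m (1, 1) + m (1, -1) - 2 * m (1, 0) - 2 * m (0, 1)) / 12,
    (m (1, 1) - m (1, -1)) / 8
      - (m (2, 1) - 12 * m (1, 0) + 3 * m (0, 1) - 3 * m (1, 1) - m (1, -1)) / 24,
    m (0, 1)]

/-- A binary quartic is interpolated from its values at `(1, 0)`, `(0, 1)`, `(1, 1)`, `(1, -1)` and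
`(2, 1)`. -/
theorem quarticCoeffs_form4 (u : ℝ × ℝ → ℝ) (q : ℝ × ℝ) :
    quarticCoeffs (form4 u q) = ![partialDeriv 4 0 u q, partialDeriv 3 1 u q,
      partialDeriv 2 2 u q, partialDeriv 1 3 u q, partialDeriv 0 4 u q] := by
  ext i
  fin_cases i <;> simp [quarticCoeffs, form4] <;> ring

theorem frameJet_eq_jet {u : ℝ × ℝ → ℝ} {q : ℝ × ℝ} {e : Fin 7 → ℝ}
    (h2 : ∀ h, form2 u q h = model2 e h) (h3 : ∀ h, form3 u q h = model3 e h) :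
    frameJet e = jet u q := by
  ext i
  fin_cases i <;> simp [frameJet, jet, ← h2, ← h3, form2, form3] <;> ring

/-- With `model3_eq`, this turns equality of `frameJet` into the equality of forms required by
`exists_symmetry`. -/
theorem model2_eq (e : Fin 7 → ℝ) (h : ℝ × ℝ) : model2 e h
    = frameJet e 0 * h.1 ^ 2 + 2 * frameJet e 1 * h.1 * h.2 + frameJet e 2 * h.2 ^ 2 := by
  simp only [frameJet, Matrix.cons_val, model2, quadraticPart, frameMap]
  ring

theorem model3_eq (e : Fin 7 → ℝ) (h : ℝ × ℝ) : model3 e h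
    = frameJet e 3 * h.1 ^ 3 + 3 * frameJet e 4 * h.1 ^ 2 * h.2
      + 3 * frameJet e 5 * h.1 * h.2 ^ 2 + frameJet e 6 * h.2 ^ 3 := by
  simp only [frameJet, Matrix.cons_val, model3, quadraticPart, cubicPart, dot, frameVec, frameMap]
  ring

theorem contDiff_frameJet : ContDiff ℝ ∞ frameJet := by
  rw [contDiff_pi]
  intro i
  fin_cases i <;> simp [frameJet, model2, model3, quadraticPart, cubicPart, dot, frameVec,
    frameMap] <;> fun_prop

/-- The standard frame. -/
def stdFrame : Fin 7 → ℝ := ![1, 1, 0, 0, 1, 0, 0]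

theorem frameMap_stdFrame (h : ℝ × ℝ) : frameMap stdFrame h = h := by
  ext <;> simp [frameMap, stdFrame]

theorem frameVec_stdFrame : frameVec stdFrame = 0 := by
  ext <;> simp [frameVec, stdFrame]

theorem hasDerivAt_model2 (v : Fin 7 → ℝ) (h : ℝ × ℝ) :
    HasDerivAt (fun t : ℝ => model2 (stdFrame + t • v) h)
      (v 0 * (h.1 ^ 2 + h.2 ^ 2) + 2 * (h.1 * (v 1 * h.1 + v 2 * h.2)
        + h.2 * (v 3 * h.1 + v 4 * h.2))) 0 := by
  have hc : ∀ i, HasDerivAt (fun t : ℝ => (stdFrame + t • v) i) (v i) 0 := fun i => by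
    simpa using ((hasDerivAt_id (0 : ℝ)).mul_const (v i)).const_add (stdFrame i)
  have x := ((hc 1).mul_const h.1).add ((hc 2).mul_const h.2)
  have y := ((hc 3).mul_const h.1).add ((hc 4).mul_const h.2)
  have := ((hc 0).const_mul 2).mul (((x.pow 2).add (y.pow 2)).const_mul (1 / 2))
  refine this.congr_deriv ?_
  simp [stdFrame]
  ring

theorem hasDerivAt_model3 (v : Fin 7 → ℝ) (h : ℝ × ℝ) :
    HasDerivAt (fun t : ℝ => model3 (stdFrame + t • v) h)
      (v 0 * (h.1 ^ 3 - 3 * h.1 * h.2 ^ 2) + 3 * (h.1 ^ 2 - h.2 ^ 2) * (v 1 * h.1 + v 2 * h.2)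
        - 6 * h.1 * h.2 * (v 3 * h.1 + v 4 * h.2)
        - 3 * (h.1 * v 5 + h.2 * v 6) * (h.1 ^ 2 + h.2 ^ 2)) 0 := by
  have hc : ∀ i, HasDerivAt (fun t : ℝ => (stdFrame + t • v) i) (v i) 0 := fun i => by
    simpa using ((hasDerivAt_id (0 : ℝ)).mul_const (v i)).const_add (stdFrame i)
  have x := ((hc 1).mul_const h.1).add ((hc 2).mul_const h.2)
  have y := ((hc 3).mul_const h.1).add ((hc 4).mul_const h.2)
  have := ((hc 0).const_mul 6).mul ((((x.pow 3).sub ((x.const_mul 3).mul (y.pow 2))).const_mul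
    (1 / 6)).sub (((x.mul (hc 5)).add (y.mul (hc 6))).mul
      (((x.pow 2).add (y.pow 2)).const_mul (1 / 2))))
  refine this.congr_deriv ?_
  simp [stdFrame]
  ring

/-- In the kernel, the quadratic part leaves only an infinitesimal rotation and a dilation
compensating the scale. On the cubic these give two independent harmonic forms, while the frame
vector gives a multiple of `x² + y²`; independence makes all three vanish. -/
theorem fderiv_frameJet_injective : Function.Injective (fderiv ℝ frameJet stdFrame) := by
  rw [injective_iff_map_eq_zero]
  intro v hv
  have hline : HasDerivAt (fun t : ℝ => stdFrame + t • v) v 0 := by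
    simpa using ((hasDerivAt_id (0 : ℝ)).smul_const v).const_add stdFrame
  have hF : HasFDerivAt frameJet (fderiv ℝ frameJet stdFrame) (stdFrame + (0 : ℝ) • v) := by
    simpa using (contDiff_frameJet.differentiable (by simp)).differentiableAt.hasFDerivAt
  have hd := hasDerivAt_pi.1 (hF.comp_hasDerivAt 0 hline)
  rw [hv] at hd
  have m2 := hasDerivAt_model2 v
  have m3 := hasDerivAt_model3 v
  have d0 := (hd 0).unique (m2 (1, 0))
  have d1 := (hd 1).unique ((((m2 (1, 1)).sub (m2 (1, 0))).sub (m2 (0, 1))).div_const 2)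
  have d2 := (hd 2).unique (m2 (0, 1))
  have d3 := (hd 3).unique (m3 (1, 0))
  have d4 := (hd 4).unique ((((m3 (1, 1)).sub (m3 (1, -1))).sub
    ((m3 (0, 1)).const_mul 2)).div_const 6)
  have d5 := (hd 5).unique ((((m3 (1, 1)).add (m3 (1, -1))).sub
    ((m3 (1, 0)).const_mul 2)).div_const 6)
  have d6 := (hd 6).unique (m3 (0, 1))
  simp only [Pi.zero_apply] at d0 d1 d2 d3 d4 d5 d6
  ext i
  fin_cases i <;> simp <;> linarith

/-- Near the standard 3-jet, frames can be chosen as a differentiable function of the 3-jet. -/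
theorem exists_local_frame : ∃ (ε : (Fin 7 → ℝ) → Fin 7 → ℝ)
    (ε' : (Fin 7 → ℝ) →L[ℝ] (Fin 7 → ℝ)), HasStrictFDerivAt ε ε' (frameJet stdFrame) ∧
      ε (frameJet stdFrame) = stdFrame ∧
      ∀ᶠ y in 𝓝 (frameJet stdFrame), frameJet (ε y) = y := by
  set L : (Fin 7 → ℝ) ≃L[ℝ] (Fin 7 → ℝ) := (LinearEquiv.ofInjectiveEndo
    (fderiv ℝ frameJet stdFrame : (Fin 7 → ℝ) →ₗ[ℝ] (Fin 7 → ℝ))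
    fderiv_frameJet_injective).toContinuousLinearEquiv with hL
  have hs : HasStrictFDerivAt frameJet (L : (Fin 7 → ℝ) →L[ℝ] (Fin 7 → ℝ)) stdFrame := by
    have : (L : (Fin 7 → ℝ) →L[ℝ] (Fin 7 → ℝ)) = fderiv ℝ frameJet stdFrame := by
      ext1; rfl
    rw [this]
    exact contDiff_frameJet.contDiffAt.hasStrictFDerivAt (by simp)
  exact ⟨hs.localInverse, L.symm, hs.to_localInverse, hs.localInverse_apply_image,
    hs.eventually_right_inverse⟩

theorem contDiff_quarticCoeffs_model4 (I40 I31 I22 I13 I04 : ℝ) : ContDiff ℝ ∞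
    (fun e => quarticCoeffs (model4 (quarticPart I40 I31 I22 I13 I04) e)) := by
  have hm : ∀ h, ContDiff ℝ ∞ (fun e => model4 (quarticPart I40 I31 I22 I13 I04) e h) := fun h => by
    simp only [model4, quarticPart, quadraticPart, cubicPart, cubicPartDeriv, dot, frameVec,
      frameMap]
    fun_prop
  rw [contDiff_pi]
  intro i
  fin_cases i <;> simp [quarticCoeffs] <;> fun_prop

theorem continuous_model4 {f : ℝ × ℝ → ℝ} (hf : Continuous f) (h : ℝ × ℝ) :
    Continuous (fun e => model4 f e h) := by
  simp only [model4, quadraticPart, cubicPart, cubicPartDeriv, dot, frameVec, frameMap]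
  fun_prop

theorem model4_stdFrame (f : ℝ × ℝ → ℝ) (h : ℝ × ℝ) : model4 f stdFrame h = 24 * f h := by
  rw [model4, frameMap_stdFrame, frameVec_stdFrame]
  simp [dot, cubicPartDeriv, stdFrame]

/-! ### Uniqueness for the finite type equation -/

/-- The derivative along `h` of the second and third partial derivatives, in terms of the third
and fourth partial derivatives. -/
def jetShift (h : ℝ × ℝ) (J : Fin 7 → ℝ) (Q : Fin 5 → ℝ) : Fin 7 → ℝ :=
  ![h.1 * J 3 + h.2 * J 4, h.1 * J 4 + h.2 * J 5, h.1 * J 5 + h.2 * J 6, h.1 * Q 0 + h.2 * Q 1,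
    h.1 * Q 1 + h.2 * Q 2, h.1 * Q 2 + h.2 * Q 3, h.1 * Q 3 + h.2 * Q 4]

theorem hasDerivAt_jet {u : ℝ × ℝ → ℝ} {U : Set (ℝ × ℝ)} (hU : IsOpen U)
    (hu : ContDiffOn ℝ ∞ u U) {q h : ℝ × ℝ} {t : ℝ} (ht : q + t • h ∈ U) :
    HasDerivAt (fun s : ℝ => jet u (q + s • h))
      (jetShift h (jet u (q + t • h)) (quarticCoeffs (form4 u (q + t • h)))) t := by
  have d := fun i j => hasDerivAt_partialDeriv_line hU hu i j ht
  rw [quarticCoeffs_form4, hasDerivAt_pi]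
  intro i
  fin_cases i
  · exact d 2 0
  · exact d 1 1
  · exact d 0 2
  · exact d 3 0
  · exact d 2 1
  · exact d 1 2
  · exact d 0 3

theorem norm_jetShift_sub_le (h : ℝ × ℝ) {J J' : Fin 7 → ℝ} {Q Q' : Fin 5 → ℝ} {C : ℝ}
    (hJ : ‖J - J'‖ ≤ C) (hQ : ‖Q - Q'‖ ≤ C) :
    ‖jetShift h J Q - jetShift h J' Q'‖ ≤ 2 * ‖h‖ * C := by
  have hC : 0 ≤ C := (norm_nonneg _).trans hJ
  have key : ∀ x y : ℝ, |x| ≤ C → |y| ≤ C → |h.1 * x + h.2 * y| ≤ 2 * ‖h‖ * C :=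
    fun x y hx hy => by
      have h1 : |h.1 * x| ≤ ‖h‖ * C := by
        rw [abs_mul]; gcongr; exact norm_fst_le h
      have h2 : |h.2 * y| ≤ ‖h‖ * C := by
        rw [abs_mul]; gcongr; exact norm_snd_le h
      linarith [abs_add_le (h.1 * x) (h.2 * y)]
  have cJ : ∀ i, |J i - J' i| ≤ C := fun i => (norm_le_pi_norm (J - J') i).trans hJ
  have cQ : ∀ i, |Q i - Q' i| ≤ C := fun i => (norm_le_pi_norm (Q - Q') i).trans hQ
  refine (pi_norm_le_iff_of_nonneg (by positivity)).2 fun i => ?_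
  rw [Real.norm_eq_abs]
  fin_cases i
  · convert key _ _ (cJ 3) (cJ 4) using 2; simp [jetShift]; ring
  · convert key _ _ (cJ 4) (cJ 5) using 2; simp [jetShift]; ring
  · convert key _ _ (cJ 5) (cJ 6) using 2; simp [jetShift]; ring
  · convert key _ _ (cQ 0) (cQ 1) using 2; simp [jetShift]; ring
  · convert key _ _ (cQ 1) (cQ 2) using 2; simp [jetShift]; ring
  · convert key _ _ (cQ 2) (cQ 3) using 2; simp [jetShift]; ring
  · convert key _ _ (cQ 3) (cQ 4) using 2; simp [jetShift]; ring

/-- A function whose fourth derivatives are a Lipschitz function of its second and third ones is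
determined by its 3-jet at a point. -/
theorem eqOn_ball_of_quarticCoeffs {u v : ℝ × ℝ → ℝ} {r : ℝ}
    (hu : ContDiffOn ℝ ∞ u (Metric.ball 0 r)) (hv : ContDiffOn ℝ ∞ v (Metric.ball 0 r))
    {G : (Fin 7 → ℝ) → Fin 5 → ℝ} {K : NNReal} {N : Set (Fin 7 → ℝ)} (hG : LipschitzOnWith K G N)
    (huN : ∀ q ∈ Metric.ball 0 r, jet u q ∈ N ∧ quarticCoeffs (form4 u q) = G (jet u q))
    (hvN : ∀ q ∈ Metric.ball 0 r, jet v q ∈ N ∧ quarticCoeffs (form4 v q) = G (jet v q))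
    (h0 : u 0 = v 0) (h1 : ∀ h, form1 u 0 h = form1 v 0 h) (h2 : jet u 0 = jet v 0) :
    Set.EqOn u v (Metric.ball 0 r) := by
  intro h hh
  have hmem : ∀ t ∈ Set.Icc (0 : ℝ) 1, (0 : ℝ × ℝ) + t • h ∈ Metric.ball (0 : ℝ × ℝ) r :=
    fun t ht => by
      rw [mem_ball_zero_iff] at hh
      rw [zero_add, mem_ball_zero_iff, norm_smul, Real.norm_of_nonneg ht.1]
      exact (mul_le_of_le_one_left (norm_nonneg _) ht.2).trans_lt hh
  have hdJ : ∀ t ∈ Set.Icc (0 : ℝ) 1, _ := fun t ht =>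
    (hasDerivAt_jet Metric.isOpen_ball hu (hmem t ht)).sub
      (hasDerivAt_jet Metric.isOpen_ball hv (hmem t ht))
  have hJ : ∀ t ∈ Set.Icc (0 : ℝ) 1, jet u (0 + t • h) = jet v (0 + t • h) := fun t ht => by
    -- The jets start equal. The factor `1 + K` covers both the difference of the jets and the
    -- difference of their images under `G`; the factor 2 comes from the two components of `h`.
    have := norm_le_gronwallBound_of_norm_deriv_right_le
      (f := fun t : ℝ => jet u (0 + t • h) - jet v (0 + t • h)) (δ := 0)
      (K := 2 * ‖h‖ * (1 + K)) (ε := 0) (a := 0) (b := 1)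
      (fun t ht => (hdJ t ht).continuousAt.continuousWithinAt)
      (fun t ht => (hdJ t (Set.Ico_subset_Icc_self ht)).hasDerivWithinAt)
      (by simp [h2]) (fun t ht => by
        have hm := hmem t (Set.Ico_subset_Icc_self ht)
        have hu' := huN _ hm
        have hv' := hvN _ hm
        set δ := ‖jet u (0 + t • h) - jet v (0 + t • h)‖ with hδ
        have hδ0 : 0 ≤ δ := norm_nonneg _
        have := norm_jetShift_sub_le h (C := (1 + K) * δ)
          (J := jet u (0 + t • h)) (J' := jet v (0 + t • h))
          (Q := quarticCoeffs (form4 u (0 + t • h))) (Q' := quarticCoeffs (form4 v (0 + t • h)))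
          (by nlinarith [K.coe_nonneg]) (by
            rw [hu'.2, hv'.2]
            have := hG.norm_sub_le hu'.1 hv'.1
            nlinarith)
        linarith) t ht
    rw [gronwallBound_ε0_δ0] at this
    exact sub_eq_zero.1 (norm_le_zero_iff.1 this)
  have hf2 : ∀ t ∈ Set.Icc (0 : ℝ) 1, form2 u (0 + t • h) h = form2 v (0 + t • h) h :=
    fun t ht => by
      have e0 := congrFun (hJ t ht) 0
      have e1 := congrFun (hJ t ht) 1
      have e2 := congrFun (hJ t ht) 2
      simp only [jet, Matrix.cons_val] at e0 e1 e2
      rw [form2, form2, e0, e1, e2]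
  -- Equal second differentials along the ray are integrated twice, with derivative bound zero.
  have hf1 := abs_sub_le_of_hasDerivAt (C := 0)
    (g := fun t : ℝ => form1 u (0 + t • h) h - form1 v (0 + t • h) h)
    (fun t ht => (hasDerivAt_form1 Metric.isOpen_ball hu (hmem t ht)).sub
      (hasDerivAt_form1 Metric.isOpen_ball hv (hmem t ht)))
    (fun t ht => by rw [hf2 t ht, sub_self, abs_zero]) le_rfl (by simp [h1])
  have hf0 := abs_sub_le_of_hasDerivAt (C := 0)
    (g := fun t : ℝ => u (0 + t • h) - v (0 + t • h))
    (fun t ht => (hasDerivAt_form0 Metric.isOpen_ball hu (hmem t ht)).sub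
      (hasDerivAt_form0 Metric.isOpen_ball hv (hmem t ht))) hf1 le_rfl (by simp [h0])
  have := hf0 1 (by simp)
  rw [zero_add, one_smul] at this
  exact sub_eq_zero.1 (abs_nonpos_iff.1 this)

/-! ### Normal form of the surface around a base point -/

/-- The case of `jet_equations` in which the curve comes from the graph of `u` itself: the
transversal direction is the vertical one, so `b = 0` and `zb = 1`. -/
theorem forms_of_isLittleO {u : ℝ × ℝ → ℝ} {U : Set (ℝ × ℝ)} (hU : IsOpen U)
    (hu : ContDiffOn ℝ ∞ u U) (h0U : (0 : ℝ × ℝ) ∈ U) (h0 : u 0 = 0) {I40 I31 I22 I13 I04 : ℝ}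
    (hjet : (fun q => u q - (quadraticPart q + cubicPart q + quarticPart I40 I31 I22 I13 I04 q))
      =o[𝓝 (0, 0)] (fun q => ‖q‖ ^ 4)) (w : ℝ × ℝ) :
    form1 u 0 w = 0 ∧ form2 u 0 w = model2 stdFrame w ∧ form3 u 0 w = model3 stdFrame w ∧
      form4 u 0 w = model4 (quarticPart I40 I31 I22 I13 I04) stdFrame w := by
  have := jet_equations hU hu h0U (a := w) (b := 0) (za := 0) (zb := 1) (f2 := quadraticPart w)
    (f3 := cubicPart w) (f4 := quarticPart I40 I31 I22 I13 I04 w)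
    (v := fun s => u (s * w.1, s * w.2)) (isLittleO_line hjet w)
    (Filter.Eventually.of_forall fun s => by
      rw [smul_zero, add_zero, zero_add, h0, mul_zero, add_zero, zero_add, mul_one]
      rfl)
  obtain ⟨e1, e2, e3, e4⟩ := this
  have z1 : form1 u 0 0 = 0 := by simp [form1]
  have z2 : form2 u 0 0 = 0 := by simp [form2]
  have z3 : form2Polar u 0 w 0 = 0 := by simp [form2Polar]
  have z4 : form3Polar u 0 w 0 = 0 := by simp [form3Polar]
  rw [z1] at e2
  rw [z1, z3] at e3
  rw [z1, z2, z3, z4] at e4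
  refine ⟨e1, ?_, ?_, ?_⟩
  · rw [model2, frameMap_stdFrame]; simp only [stdFrame, Matrix.cons_val]; linarith
  · rw [model3, frameMap_stdFrame, frameVec_stdFrame]
    simp only [stdFrame, Matrix.cons_val, dot, Prod.fst_zero, Prod.snd_zero]; linarith
  · rw [model4_stdFrame]; linarith

theorem continuousAt_jet {u : ℝ × ℝ → ℝ} {U : Set (ℝ × ℝ)} (hU : IsOpen U)
    (hu : ContDiffOn ℝ ∞ u U) {q : ℝ × ℝ} (hq : q ∈ U) : ContinuousAt (jet u) q := by
  have d := fun i j =>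
    (contDiffOn_partialDeriv hU hu i j).continuousOn.continuousAt (hU.mem_nhds hq)
  refine continuousAt_pi.2 fun i => ?_
  fin_cases i
  · exact d 2 0
  · exact d 1 1
  · exact d 0 2
  · exact d 3 0
  · exact d 2 1
  · exact d 1 2
  · exact d 0 3

theorem continuousAt_form4 {u : ℝ × ℝ → ℝ} {U : Set (ℝ × ℝ)} (hU : IsOpen U)
    (hu : ContDiffOn ℝ ∞ u U) {q : ℝ × ℝ} (hq : q ∈ U) (h : ℝ × ℝ) :
    ContinuousAt (fun p => form4 u p h) q := by
  have d := fun i j =>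
    (contDiffOn_partialDeriv hU hu i j).continuousOn.continuousAt (hU.mem_nhds hq)
  have d0 := d 4 0
  have d1 := d 3 1
  have d2 := d 2 2
  have d3 := d 1 3
  have d4 := d 0 4
  simp only [form4]
  fun_prop

/-- If the 4-jets of `u` near `0` are standard in some frames, with constant quartic part, then
they are standard in the frames chosen as a continuous function of the 3-jet. -/
theorem eventually_form4_eq {u : ℝ × ℝ → ℝ} {U : Set (ℝ × ℝ)} (hU : IsOpen U)
    (hu : ContDiffOn ℝ ∞ u U) (h0U : (0 : ℝ × ℝ) ∈ U) {f : ℝ × ℝ → ℝ} (hf : Continuous f)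
    (hframe : ∀ᶠ q in 𝓝 (0 : ℝ × ℝ), ∃ e : Fin 7 → ℝ, (∀ h, form2 u q h = model2 e h) ∧
      (∀ h, form3 u q h = model3 e h) ∧ ∀ h, form4 u q h = model4 f e h)
    (hjet : jet u 0 = frameJet stdFrame) (h4 : ∀ h, form4 u 0 h = model4 f stdFrame h)
    {ε : (Fin 7 → ℝ) → Fin 7 → ℝ} (hε : ContinuousAt ε (frameJet stdFrame))
    (hε0 : ε (frameJet stdFrame) = stdFrame)
    (hinv : ∀ᶠ y in 𝓝 (frameJet stdFrame), frameJet (ε y) = y) :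
    ∀ᶠ q in 𝓝 (0 : ℝ × ℝ), ∀ h, form4 u q h = model4 f (ε (jet u q)) h := by
  have hJc : Filter.Tendsto (jet u) (𝓝 0) (𝓝 (frameJet stdFrame)) := by
    rw [← hjet]; exact continuousAt_jet hU hu h0U
  have hεc : Filter.Tendsto (fun q => ε (jet u q)) (𝓝 0) (𝓝 stdFrame) := by
    have := hε.tendsto.comp hJc
    rwa [hε0] at this
  have hscale : ∀ᶠ e in 𝓝 stdFrame, e 0 ≠ 0 ∧ e 1 * e 4 - e 2 * e 3 ≠ 0 := by
    refine Filter.Eventually.and ?_ ?_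
    · exact (Continuous.continuousAt (by fun_prop)).eventually_ne (by simp [stdFrame])
    · exact (Continuous.continuousAt (by fun_prop)).eventually_ne (by simp [stdFrame])
  -- A candidate with `f ∘ m ≠ f` violates the formula at the origin in some direction `h`, hence
  -- also nearby by continuity. Finiteness of the set of candidates gives one common neighbourhood.
  have hsymm : ∀ᶠ q in 𝓝 (0 : ℝ × ℝ), ∀ m ∈ symmetryCandidates,
      (∀ h, form4 u q h = model4 (f ∘ orthMap m) (ε (jet u q)) h) → f ∘ orthMap m = f := by
    refine (Filter.eventually_all_finset _).2 fun m _ => ?_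
    by_cases hm : f ∘ orthMap m = f
    · exact Filter.Eventually.of_forall fun _ _ => hm
    · obtain ⟨h, hh⟩ := Function.ne_iff.1 hm
      have hfm : Continuous (f ∘ orthMap m) := hf.comp (by unfold orthMap; fun_prop)
      have t1 : Filter.Tendsto (fun q => form4 u q h
          - model4 (f ∘ orthMap m) (ε (jet u q)) h) (𝓝 0)
          (𝓝 (form4 u 0 h - model4 (f ∘ orthMap m) stdFrame h)) :=
        (continuousAt_form4 hU hu h0U h).tendsto.sub
          (((continuous_model4 hfm h).tendsto stdFrame).comp hεc)
      have t2 : form4 u 0 h - model4 (f ∘ orthMap m) stdFrame h ≠ 0 := by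
        rw [h4, model4_stdFrame, model4_stdFrame]
        intro hz
        exact hh (by linarith)
      filter_upwards [t1.eventually_ne t2] with q hq hall
      exact absurd (sub_eq_zero.2 (hall h)) hq
  filter_upwards [hframe, hsymm, hεc.eventually hscale, hJc.eventually hinv]
    with q ⟨e, e2, e3, e4⟩ hq ⟨hs1, hs2⟩ hi
  have hJ : frameJet (ε (jet u q)) = frameJet e := by rw [hi, frameJet_eq_jet e2 e3]
  obtain ⟨m, hm, hmf⟩ := exists_symmetry (e' := e) hs1 hs2
    (fun h => by rw [model2_eq, model2_eq e, hJ]) (fun h => by rw [model3_eq, model3_eq e, hJ])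
  have hall : ∀ h, form4 u q h = model4 (f ∘ orthMap m) (ε (jet u q)) h := fun h => by
    rw [e4, hmf]
  have hfm := hq m hm hall
  rwa [hfm] at hall

/-- In the affine coordinates `T`, which put the origin at `p`, the surface `S` is near `p` the
graph of a function `u` which is standard at `0` up to order three and whose fourth derivatives on
a ball of radius `r` are the function `G` of the lower ones, which stay in `N`. -/
theorem exists_determined_graph {S : Set A3} {p : A3} {I40 I31 I22 I13 I04 : ℝ} (hp : p ∈ S)
    (hI : HasConstantCurvatures S I40 I31 I22 I13 I04)
    {ε : (Fin 7 → ℝ) → Fin 7 → ℝ} (hε : ContinuousAt ε (frameJet stdFrame))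
    (hε0 : ε (frameJet stdFrame) = stdFrame)
    (hinv : ∀ᶠ y in 𝓝 (frameJet stdFrame), frameJet (ε y) = y)
    {N : Set (Fin 7 → ℝ)} (hN : N ∈ 𝓝 (frameJet stdFrame)) :
    ∃ (T : A3 ≃ᵃ[ℝ] A3) (u : ℝ × ℝ → ℝ), T p = 0 ∧
      (∃ V : Set A3, IsOpen V ∧ p ∈ V ∧ ∀ w ∈ V, (w ∈ S ↔ T w 2 = u (T w 0, T w 1))) ∧
      u 0 = 0 ∧ (∀ h, form1 u 0 h = 0) ∧ jet u 0 = frameJet stdFrame ∧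
      ∃ r > 0, ContDiffOn ℝ ∞ u (Metric.ball 0 r) ∧ ∀ q ∈ Metric.ball 0 r, jet u q ∈ N ∧
        quarticCoeffs (form4 u q)
          = quarticCoeffs (model4 (quarticPart I40 I31 I22 I13 I04) (ε (jet u q))) := by
  obtain ⟨T, u, ⟨hbase, ⟨U, hU, h0U, hu⟩, V, hV, hpV, hgraph⟩, hjet⟩ := hI p hp
  have h0U' : (0 : ℝ × ℝ) ∈ U := h0U
  have hu0 : u 0 = 0 := by
    have := (hgraph p hpV).1 hp
    rw [hbase] at this
    exact this.symm
  have hforms := forms_of_isLittleO hU hu h0U' hu0 hjet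
  have hJ0 : jet u 0 = frameJet stdFrame :=
    (frameJet_eq_jet (fun h => (hforms h).2.1) (fun h => (hforms h).2.2.1)).symm
  have hsymm0 : T.symm ![(0 : ℝ × ℝ).1, (0 : ℝ × ℝ).2, u 0] = p := by
    rw [hu0, AffineEquiv.symm_apply_eq, hbase]
    ext i; fin_cases i <;> rfl
  have hpt : Filter.Tendsto (fun q : ℝ × ℝ => T.symm ![q.1, q.2, u q]) (𝓝 0) (𝓝 p) := by
    rw [← hsymm0]
    refine (T.symm.continuous_of_finiteDimensional.tendsto _).comp (tendsto_pi_nhds.2 fun i => ?_)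
    fin_cases i
    · exact continuous_fst.tendsto _
    · exact continuous_snd.tendsto _
    · exact hu.continuousOn.continuousAt (hU.mem_nhds h0U')
  have hframe : ∀ᶠ q in 𝓝 (0 : ℝ × ℝ), ∃ e : Fin 7 → ℝ, (∀ h, form2 u q h = model2 e h) ∧
      (∀ h, form3 u q h = model3 e h) ∧
      ∀ h, form4 u q h = model4 (quarticPart I40 I31 I22 I13 I04) e h := by
    filter_upwards [hpt (hV.mem_nhds hpV), hU.mem_nhds h0U'] with q hqV hqU
    refine exists_frame_of_hasCurvaturesAt hU hu hV hgraph hqU hqV (hI _ ?_)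
    rw [hgraph _ hqV, AffineEquiv.apply_symm_apply]
    simp
  have hev := eventually_form4_eq hU hu h0U' (by unfold quarticPart; fun_prop) hframe hJ0
    (fun h => (hforms h).2.2.2) hε hε0 hinv
  have hJN : ∀ᶠ q in 𝓝 (0 : ℝ × ℝ), jet u q ∈ N :=
    (continuousAt_jet hU hu h0U') (by rwa [hJ0])
  obtain ⟨r, hr, hball⟩ := Metric.eventually_nhds_iff_ball.1
    ((hev.and hJN).and (hU.mem_nhds h0U'))
  refine ⟨T, u, hbase, ⟨V, hV, hpV, hgraph⟩, hu0, fun h => (hforms h).1, hJ0, r, hr,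
    hu.mono fun q hq => (hball q hq).2, fun q hq => ⟨(hball q hq).1.2, ?_⟩⟩
  congr 1
  exact funext (hball q hq).1.1

/-! ### Affine congruence -/

theorem affinelyCongruentAt_of_eqOn {S S' : Set A3} {p p' : A3} {T T' : A3 ≃ᵃ[ℝ] A3}
    {u u' : ℝ × ℝ → ℝ} (hT : T p = 0) (hT' : T' p' = 0)
    (hV : ∃ V : Set A3, IsOpen V ∧ p ∈ V ∧ ∀ w ∈ V, (w ∈ S ↔ T w 2 = u (T w 0, T w 1)))
    (hV' : ∃ V : Set A3, IsOpen V ∧ p' ∈ V ∧ ∀ w ∈ V, (w ∈ S' ↔ T' w 2 = u' (T' w 0, T' w 1)))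
    {W : Set (ℝ × ℝ)} (hW : IsOpen W) (h0 : (0 : ℝ × ℝ) ∈ W) (huu' : Set.EqOn u u' W) :
    AffinelyCongruentAt S p S' p' := by
  obtain ⟨V, hVo, hpV, hgraph⟩ := hV
  obtain ⟨V', hVo', hpV', hgraph'⟩ := hV'
  set R : A3 ≃ᵃ[ℝ] A3 := T.trans T'.symm with hR
  have hRp : R p = p' := by
    rw [hR, AffineEquiv.trans_apply, hT, AffineEquiv.symm_apply_eq, hT']
  have hTR : ∀ w, T (R.symm w) = T' w := fun w => by
    rw [← AffineEquiv.symm_apply_eq T', ← AffineEquiv.trans_apply, ← hR,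
      AffineEquiv.apply_symm_apply]
  have hT'c : Continuous T' := T'.continuous_of_finiteDimensional
  refine ⟨R, hRp, V' ∩ R.symm ⁻¹' V ∩ (fun w => (T' w 0, T' w 1)) ⁻¹' W, ?_, ?_, ?_⟩
  · exact (hVo'.inter (hVo.preimage R.symm.continuous_of_finiteDimensional)).inter
      (hW.preimage (by fun_prop))
  · refine ⟨⟨hpV', ?_⟩, ?_⟩
    · rw [Set.mem_preimage, ← hRp, AffineEquiv.symm_apply_apply]; exact hpV
    · rw [Set.mem_preimage, hT']; exact h0
  · ext w
    refine and_congr_left fun ⟨⟨hw', hw⟩, hwW⟩ => ?_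
    have himage : w ∈ R '' S ↔ R.symm w ∈ S :=
      ⟨fun ⟨x, hx, hxw⟩ => by rwa [← hxw, AffineEquiv.symm_apply_apply],
        fun h => ⟨_, h, AffineEquiv.apply_symm_apply _ _⟩⟩
    rw [himage, hgraph _ hw, hgraph' _ hw', hTR, huu' hwW]

end EllipticalSurface

theorem theorem5p3 (S S' : Set EllipticalSurface.A3) (I40 I31 I22 I13 I04 : ℝ)
    (hS : EllipticalSurface.IsRegularElliptical S)
    (hS' : EllipticalSurface.IsRegularElliptical S')
    (hI : EllipticalSurface.HasConstantCurvatures S I40 I31 I22 I13 I04)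
    (hI' : EllipticalSurface.HasConstantCurvatures S' I40 I31 I22 I13 I04) :
    ∀ p ∈ S, ∀ p' ∈ S', EllipticalSurface.AffinelyCongruentAt S p S' p' := by
  open EllipticalSurface in
  intro p hp p' hp'
  -- One choice of `ε`, made before either surface is normalized, gives both surfaces the same `G`.
  obtain ⟨ε, ε', hε, hε0, hinv⟩ := exists_local_frame
  have hG : HasStrictFDerivAt
      (fun y => quarticCoeffs (model4 (quarticPart I40 I31 I22 I13 I04) (ε y))) _
      (frameJet stdFrame) :=
    HasStrictFDerivAt.comp (f := ε) (frameJet stdFrame)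
      ((contDiff_quarticCoeffs_model4 I40 I31 I22 I13 I04).contDiffAt.hasStrictFDerivAt (by simp))
      hε
  -- Strict differentiability at the standard jet suffices for a Lipschitz bound on a neighbourhood
  -- `N`, which is all that Gronwall's inequality needs.
  obtain ⟨K, N, hN, hlip⟩ := hG.exists_lipschitzOnWith
  obtain ⟨T, u, hT, hV, hu0, hu1, huJ, r, hr, hu, huN⟩ :=
    exists_determined_graph hp hI hε.continuousAt hε0 hinv hN
  obtain ⟨T', u', hT', hV', hu0', hu1', huJ', r', hr', hu', huN'⟩ :=
    exists_determined_graph hp' hI' hε.continuousAt hε0 hinv hN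
  have hsub : Metric.ball (0 : ℝ × ℝ) (min r r') ⊆ Metric.ball 0 r :=
    Metric.ball_subset_ball (min_le_left _ _)
  have hsub' : Metric.ball (0 : ℝ × ℝ) (min r r') ⊆ Metric.ball 0 r' :=
    Metric.ball_subset_ball (min_le_right _ _)
  refine affinelyCongruentAt_of_eqOn hT hT' hV hV' Metric.isOpen_ball
    (Metric.mem_ball_self (lt_min hr hr'))
    (eqOn_ball_of_quarticCoeffs (hu.mono hsub) (hu'.mono hsub') hlip
      (fun q hq => huN q (hsub hq)) (fun q hq => huN' q (hsub' hq)) (by rw [hu0, hu0'])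
      (fun h => by rw [hu1, hu1']) (by rw [huJ, huJ']))
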